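/- Let $\mathbb{F}$ be an algebraically closed field of characteristic zero and let $\Lambda(n)$ be the Grassmann superalgebra over $\mathbb{F}$ with odd generators $\xi_1,\dots,\xi_n$. For $u=\{i_1<\dots<i_k\}\subseteq\{1,\dots,n\}$ write $|u|=k$ and $x^u=\xi_{i_1}\cdots\xi_{i_k}$, and let $\partial_i=\partial/\partial\xi_i$. Consider the following Lie superalgebras of operators on $\Lambda(n)$, with the bracket $[D,E]=DE-(-1)^{|D||E|}ED$ for homogeneous $D,E$: - $W(n)=\operatorname{der}\Lambda(n)$, the Lie superalgebra of superderivations of $\Lambda(n)$; - $S(n)=\bigoplus_{k=-1}^{n-2}S(n)_k$, where $S(n)_k=\operatorname{span}\{D_{ij}(x^u)\mid |u|=k+2,\ 1\le i,j\le n\}$ and $D_{ij}(f)=\partial_i(f)\,\partial_j+\partial_j(f)\,\partial_i$; - $\widetilde S(2m)=\operatorname{span}\{(1+\xi_1\cdots\xi_{2m})\partial_j\mid 1\le j\le 2m\}\oplus\bigoplus_{k=0}^{2m-2}S(2m)_k\subset W(2m)$; - $H(n)=\bigoplus_{k=-1}^{n-3}H(n)_k$, where $H(n)_k=\operatorname{span}\{D_H(x^u)\mid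 |u|=k+2\}$ and $D_H(f)=(-1)^{|f|}\sum_{i=1}^n\partial_i(f)\,\partial_{i'}$ for homogeneous $f$; here, with $r=\lfloor n/2\rfloor$, $i\mapsto i'$ is the involution of $\{1,\dots,n\}$ with $i'=i+r$ for $i\le r$, and $n'=n$ if $n$ is odd. **Theorem.** Any Cartan Lie superalgebra is generated by one element. That is, if $L$ is one of $W(n)$ $(n\ge 3)$, $S(n)$ $(n\ge 4)$, $\widetilde S(2m)$ $(m\ge 2)$ or $H(n)$ $(n\ge 5)$, then there is an element $x\in L$ such that $L$ is the smallest sub-Lie superalgebra (that is, the smallest $\mathbb{Z}/2$-graded subspace closed under the bracket) containing $x$. -/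

import Mathlib

namespace CartanSuper

noncomputable section

variable (K : Type*) [Field K] (n : ℕ)

/-- The Grassmann superalgebra `Λ(n)` in `n` generators. -/
abbrev Grassmann : Type _ := ExteriorAlgebra K (Fin n → K)

/-- The homogeneous subspaces `Λ(n)_0` (even) and `Λ(n)_1` (odd) of `Λ(n)`. -/
abbrev parity (i : ZMod 2) : Submodule K (Grassmann K n) :=
  CliffordAlgebra.evenOdd (0 : QuadraticForm K (Fin n → K)) i

/-- The underlying space of the general linear Lie superalgebra of `Λ(n)`. -/
abbrev Gl : Type _ := Module.End K (Grassmann K n)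

/-- The homogeneous subspaces of `gl(Λ(n))`: the operators of parity `i`. -/
def glParity (i : ZMod 2) : Submodule K (Gl K n) where
  carrier := {D | ∀ j, ∀ f ∈ parity K n j, D f ∈ parity K n (j + i)}
  add_mem' hD hE j f hf := add_mem (hD j f hf) (hE j f hf)
  zero_mem' _ _ _ := zero_mem _
  smul_mem' c _ hD j f hf := Submodule.smul_mem _ c (hD j f hf)

variable {K n}

/-- The superbracket `[D, E] = D E - (-1)^{ij} E D` of operators of parities `i` and `j`. -/
def superBracket (i j : ZMod 2) (D E : Gl K n) : Gl K n :=
  D * E - (-1 : K) ^ (i.val * j.val) • (E * D)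

/-- Sub-Lie superalgebras of `gl(Λ(n))`: `ℤ/2`-graded subspaces closed under the superbracket
(by bilinearity it is enough to say this for homogeneous elements). -/
structure IsSubLieSuperalgebra (M : Submodule K (Gl K n)) : Prop where
  graded : M = (M ⊓ glParity K n 0) ⊔ (M ⊓ glParity K n 1)
  bracket_mem : ∀ i j : ZMod 2, ∀ D ∈ M ⊓ glParity K n i, ∀ E ∈ M ⊓ glParity K n j,
    superBracket i j D E ∈ M

/-- `⟨s⟩`: the smallest sub-Lie superalgebra containing the set `s`
(see `isSubLieSuperalgebra_lieSuperSpan`). -/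
def lieSuperSpan (s : Set (Gl K n)) : Submodule K (Gl K n) :=
  sInf {M | IsSubLieSuperalgebra M ∧ s ⊆ M}

theorem glParity_disjoint {D : Gl K n} (h0 : D ∈ glParity K n 0) (h1 : D ∈ glParity K n 1) :
    D = 0 := by
  have hc := CliffordAlgebra.evenOdd_isCompl (0 : QuadraticForm K (Fin n → K))
  have key : ∀ j, ∀ f ∈ parity K n j, D f = 0 := by
    intro j f hf
    have a := h0 j f hf
    have b := h1 j f hf
    fin_cases j
    · exact Submodule.disjoint_def.1 hc.disjoint _ a b
    · exact Submodule.disjoint_def.1 hc.disjoint _ b a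
  refine LinearMap.ext fun f => ?_
  have hf : D f = 0 := by
    have hm : f ∈ parity K n 0 ⊔ parity K n 1 := by
      rw [show parity K n 0 ⊔ parity K n 1 = ⊤ from hc.sup_eq_top]; trivial
    obtain ⟨a, ha, b, hb, rfl⟩ := Submodule.mem_sup.1 hm
    rw [map_add, key 0 a ha, key 1 b hb, add_zero]
  simpa using hf

theorem glParity_sup : glParity K n 0 ⊔ glParity K n 1 = ⊤ := by
  have hc := CliffordAlgebra.evenOdd_isCompl (0 : QuadraticForm K (Fin n → K))
  refine eq_top_iff.2 fun D _ => ?_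
  let p : Gl K n := Submodule.projection _ _ hc
  let q : Gl K n := Submodule.projection _ _ hc.symm
  have hpq : ∀ f, p f + q f = f := Submodule.projection_add_projection_eq_self hc
  have hp : ∀ f, p f ∈ parity K n 0 := Submodule.projection_apply_mem hc
  have hq : ∀ f, q f ∈ parity K n 1 := Submodule.projection_apply_mem hc.symm
  have hp1 : ∀ f ∈ parity K n 1, p f = 0 := fun f hf =>
    (Submodule.projection_apply_eq_zero_iff hc).2 hf
  have hq0 : ∀ f ∈ parity K n 0, q f = 0 := fun f hf =>
    (Submodule.projection_apply_eq_zero_iff hc.symm).2 hf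
  have hD : D = (p * D * p + q * D * q) + (q * D * p + p * D * q) := by
    refine LinearMap.ext fun f => ?_
    simp only [LinearMap.add_apply, Module.End.mul_apply]
    calc
      D f = (p (D (p f)) + q (D (p f))) + (p (D (q f)) + q (D (q f))) := by
        rw [hpq (D (p f)), hpq (D (q f)), ← map_add, hpq]
      _ = _ := by abel
  rw [hD]
  refine Submodule.add_mem_sup (fun j f hf => ?_) (fun j f hf => ?_)
  · fin_cases j
    · change p (D (p f)) + q (D (q f)) ∈ parity K n 0
      rw [hq0 f hf, map_zero, map_zero, add_zero]
      exact hp _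
    · change p (D (p f)) + q (D (q f)) ∈ parity K n 1
      rw [hp1 f hf, map_zero, map_zero, zero_add]
      exact hq _
  · fin_cases j
    · change q (D (p f)) + p (D (q f)) ∈ parity K n 1
      rw [hq0 f hf, map_zero, map_zero, add_zero]
      exact hq _
    · change q (D (p f)) + p (D (q f)) ∈ parity K n 0
      rw [hp1 f hf, map_zero, map_zero, zero_add]
      exact hp _

theorem isSubLieSuperalgebra_lieSuperSpan (s : Set (Gl K n)) :
    IsSubLieSuperalgebra (lieSuperSpan s) where
  graded := by
    refine le_antisymm (fun D hD => ?_) (sup_le inf_le_left inf_le_left)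
    have hmem := Submodule.mem_sInf.1 hD
    by_cases hs : ∃ M : Submodule K (Gl K n), IsSubLieSuperalgebra M ∧ s ⊆ M
    · obtain ⟨M, hM⟩ := hs
      have hDM := hmem M hM
      rw [hM.1.graded] at hDM
      obtain ⟨a, ha, b, hb, rfl⟩ := Submodule.mem_sup.1 hDM
      have hab : ∀ N : Submodule K (Gl K n), IsSubLieSuperalgebra N ∧ s ⊆ N → a ∈ N ∧ b ∈ N := by
        intro N hN
        have hDN := hmem N hN
        rw [hN.1.graded] at hDN
        obtain ⟨a', ha', b', hb', hsum⟩ := Submodule.mem_sup.1 hDN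
        have h1 : a' - a = b - b' := by
          rw [sub_eq_sub_iff_add_eq_add, hsum, add_comm]
        have h0 : a' - a = 0 := by
          refine glParity_disjoint (sub_mem ha'.2 ha.2) ?_
          rw [h1]
          exact sub_mem hb.2 hb'.2
        have h2 : b - b' = 0 := h1 ▸ h0
        rw [← sub_eq_zero.1 h0, sub_eq_zero.1 h2]
        exact ⟨ha'.1, hb'.1⟩
      exact Submodule.add_mem_sup
        ⟨Submodule.mem_sInf.2 fun N hN => (hab N hN).1, ha.2⟩
        ⟨Submodule.mem_sInf.2 fun N hN => (hab N hN).2, hb.2⟩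
    · exfalso
      refine hs ⟨⊤, ⟨?_, fun _ _ _ _ _ _ => trivial⟩, fun _ _ => trivial⟩
      rw [top_inf_eq, top_inf_eq, glParity_sup]
  bracket_mem i j D hD E hE := Submodule.mem_sInf.2 fun M hM =>
    hM.1.bracket_mem i j D ⟨Submodule.mem_sInf.1 hD.1 M hM, hD.2⟩ E
      ⟨Submodule.mem_sInf.1 hE.1 M hM, hE.2⟩

variable (K n)

/-- The generator `ξ_i` of `Λ(n)`. -/
def xi (i : Fin n) : Grassmann K n := ExteriorAlgebra.ι K (Pi.single i 1)

/-- The monomial `x^u = ξ_{i_1} ⋯ ξ_{i_k}` for `u = {i_1 < ⋯ < i_k}`. -/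
def mono (u : Finset (Fin n)) : Grassmann K n := ((u.sort (· ≤ ·)).map (xi K n)).prod

/-- `∂/∂ξ_i`, the odd superderivation with `∂ξ_j/∂ξ_i = δ_ij` (left contraction with the `i`-th
coordinate form). -/
def pd (i : Fin n) : Gl K n :=
  CliffordAlgebra.contractLeft (Q := (0 : QuadraticForm K (Fin n → K))) (LinearMap.proj i)

variable {K n}

/-- The operator `f ∂/∂ξ_i`. -/
def vf (f : Grassmann K n) (i : Fin n) : Gl K n := LinearMap.mulLeft K f * pd K n i

/-- `D_ij(f) = ∂f/∂ξ_i ∂/∂ξ_j + ∂f/∂ξ_j ∂/∂ξ_i`. -/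
def Dij (i j : Fin n) (f : Grassmann K n) : Gl K n :=
  vf (pd K n i f) j + vf (pd K n j f) i

/-- The involution `i ↦ i'` of the indices (here numbered `0, …, n - 1`): with `r = ⌊n/2⌋` it
exchanges the `i`-th and the `(i + r)`-th index for `i < r` and fixes the last one if `n` is odd. -/
def prime (i : Fin n) : Fin n :=
  ⟨if (i : ℕ) < n / 2 then i + n / 2 else if (i : ℕ) < 2 * (n / 2) then i - n / 2 else i, by
    have := i.isLt
    split_ifs <;> omega⟩

/-- `D_H(f) = (-1)^{|f|} ∑_i ∂f/∂ξ_i ∂/∂ξ_{i'}`; the sign is the grade involution of `Λ(n)`. -/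
def DH (f : Grassmann K n) : Gl K n :=
  ∑ i : Fin n, vf (pd K n i (CliffordAlgebra.involute f)) (prime i)

variable (K n)

/-- The superderivations of `Λ(n)` of parity `i`:
`D(fg) = D(f) g + (-1)^{i|f|} f D(g)` for homogeneous `f`. -/
def superDer (i : ZMod 2) : Submodule K (Gl K n) where
  carrier := {D | D ∈ glParity K n i ∧ ∀ j, ∀ f ∈ parity K n j, ∀ g,
    D (f * g) = D f * g + (-1 : K) ^ (i.val * j.val) • (f * D g)}
  add_mem' := by
    rintro D E ⟨hD, hD'⟩ ⟨hE, hE'⟩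
    refine ⟨add_mem hD hE, fun j f hf g => ?_⟩
    simp only [LinearMap.add_apply, hD' j f hf g, hE' j f hf g, add_mul, mul_add, smul_add]
    abel
  zero_mem' := ⟨zero_mem _, fun j f hf g => by simp⟩
  smul_mem' := by
    rintro c D ⟨hD, hD'⟩
    refine ⟨Submodule.smul_mem _ c hD, fun j f hf g => ?_⟩
    simp only [LinearMap.smul_apply, hD' j f hf g, smul_add, smul_mul_assoc, mul_smul_comm]
    rw [smul_comm c]

/-- `W(n) = der Λ(n)`. -/
def W : Submodule K (Gl K n) := superDer K n 0 ⊔ superDer K n 1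

/-- The component `S(n)_{d-2}`, spanned by the `D_ij(x^u)` with `|u| = d`. -/
def SComp (d : ℕ) : Submodule K (Gl K n) :=
  Submodule.span K {D | ∃ (i j : Fin n) (u : Finset (Fin n)), u.card = d ∧ D = Dij i j (mono K n u)}

/-- `S(n)`, the sum of its components of degrees `-1, …, n - 2`. -/
def S : Submodule K (Gl K n) := ⨆ d ∈ Finset.Icc 1 n, SComp K n d

/-- `S̃(n)` (for even `n`): the sum of the span of the `(1 + ξ_1 ⋯ ξ_n) ∂/∂ξ_j` and of the
components of `S(n)` of degrees `0, …, n - 2`. -/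
def STilde : Submodule K (Gl K n) :=
  Submodule.span K (Set.range fun j : Fin n => vf (1 + mono K n Finset.univ) j) ⊔
    ⨆ d ∈ Finset.Icc 2 n, SComp K n d

/-- The component `H(n)_{d-2}`, spanned by the `D_H(x^u)` with `|u| = d`. -/
def HComp (d : ℕ) : Submodule K (Gl K n) :=
  Submodule.span K {D | ∃ u : Finset (Fin n), u.card = d ∧ D = DH (mono K n u)}

/-- `H(n)`, the sum of its components of degrees `-1, …, n - 3`. -/
def H : Submodule K (Gl K n) := ⨆ d ∈ Finset.Icc 1 (n - 1), HComp K n d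

variable {K n}

/-- `L` is (a sub-Lie superalgebra and) generated, as a Lie superalgebra, by one of its elements:
some `x ∈ L` is such that the smallest sub-Lie superalgebra containing `x` is `L`. -/
def IsGeneratedByOne (L : Submodule K (Gl K n)) : Prop :=
  ∃ x ∈ L, lieSuperSpan {x} = L

end

end CartanSuper

/-! Take x = h + ∑ v_q, with h = ∑ a_k ξ_k∂_k an even diagonal field in L and the v_q odd weight
vectors of L. A graded subspace containing x contains h and ∑ v_q. If the a_k are generic enough for
the v_q to have distinct eigenvalues under ad h, invariance under ad h then isolates each v_q
(`isGeneratedByOne_of_eigenvectors`). It remains to see that each L is closed under the bracket, and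
to choose separated odd weight vectors generating it.

For S(n) these are the x^u∂_i with |u| even and i ∉ u. Bracketing with ∂_j yields the odd |u| except
|u| = n - 1, which is reached by raising with a quadratic divergence-free field (`vf_mem_of_even`);
the D_ij(x^u) follow (`Dij_mem_of_vf_mem`). W(n) needs one more field, of nonzero divergence
(`vf_mem_of_divergence`). In S̃(n), with ω = ξ_1⋯ξ_n, the field (1 + ω)∂_j replaces ∂_j; it is still
a weight vector because ∑ a_k = 0 gives ω weight zero.

For H(n) the fields correspond to functions and the bracket to the Poisson bracket, and h requires
a_{k'} = -a_k. The v_q come from the monomials of degree 1 or 3 that contain no pair k ≠ k'. They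
yield all cubic monomials (`ham_mem_of_nodup_triple`), and brackets with cubics raise the degree one
step at a time up to n - 1 (`ham_lp_mem`). -/

namespace CartanSuper

noncomputable section

/-! ### Monomials and derivatives in the Grassmann algebra -/

section Grassmann

variable {K : Type*} [Field K] {n : ℕ}

/-- The product `ξ_{i_1} ⋯ ξ_{i_k}` of the generators indexed by a list. -/
def lp (K : Type*) [Field K] {n : ℕ} (l : List (Fin n)) : Grassmann K n := (l.map (xi K n)).prod

@[simp] theorem lp_nil : lp K ([] : List (Fin n)) = 1 := rfl

theorem lp_cons (a : Fin n) (l : List (Fin n)) : lp K (a :: l) = xi K n a * lp K l := by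
  simp [lp]

theorem lp_append (l l' : List (Fin n)) : lp K (l ++ l') = lp K l * lp K l' := by
  simp [lp]

theorem mono_eq_lp (u : Finset (Fin n)) : mono K n u = lp K (u.sort (· ≤ ·)) := rfl

theorem xi_mul_self (a : Fin n) : xi K n a * xi K n a = 0 := ExteriorAlgebra.ι_sq_zero _

theorem xi_mul_xi (a b : Fin n) : xi K n a * xi K n b = -(xi K n b * xi K n a) :=
  eq_neg_of_add_eq_zero_left (ExteriorAlgebra.ι_add_mul_swap _ _)

theorem xi_mul_xi_mul (a : Fin n) (f : Grassmann K n) : xi K n a * (xi K n a * f) = 0 := by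
  rw [← mul_assoc, xi_mul_self, zero_mul]

theorem xi_mul_xi_mul_comm (a b : Fin n) (f : Grassmann K n) :
    xi K n a * (xi K n b * f) = -(xi K n b * (xi K n a * f)) := by
  rw [← mul_assoc, xi_mul_xi, neg_mul, mul_assoc]

theorem lp_perm {l l' : List (Fin n)} (h : l.Perm l') : lp K l = lp K l' ∨ lp K l = -lp K l' := by
  induction h with
  | nil => exact Or.inl rfl
  | cons a _ ih =>
    rcases ih with h | h
    · left; rw [lp_cons, lp_cons, h]
    · right; rw [lp_cons, lp_cons, h, mul_neg]
  | swap a b l =>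
    right
    rw [lp_cons, lp_cons, lp_cons, lp_cons, xi_mul_xi_mul_comm]
  | trans _ _ h1 h2 =>
    rcases h1 with h1 | h1 <;> rcases h2 with h2 | h2 <;> simp [h1, h2]

/-- Reordering changes a monomial at most by a sign, which a subspace does not see. Index sets can
thus be handled as lists, in whatever order suits the computation. -/
theorem lp_perm_mem (φ : Grassmann K n →ₗ[K] Gl K n) {M : Submodule K (Gl K n)}
    {l l' : List (Fin n)} (h : l.Perm l') (hl : φ (lp K l) ∈ M) : φ (lp K l') ∈ M := by
  rcases lp_perm (K := K) h.symm with h | h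
  · rwa [h]
  · rw [h, map_neg]; exact neg_mem hl

theorem xi_mul_lp {a : Fin n} {l : List (Fin n)} (h : a ∈ l) : xi K n a * lp K l = 0 := by
  rcases lp_perm (K := K) (List.perm_cons_erase h) with h | h <;>
    rw [h, lp_cons] <;> simp [xi_mul_xi_mul]

theorem lp_of_not_nodup {l : List (Fin n)} (h : ¬ l.Nodup) : lp K l = 0 := by
  induction l with
  | nil => simp at h
  | cons a l ih =>
    rw [lp_cons]
    by_cases ha : a ∈ l
    · exact xi_mul_lp ha
    · rw [ih (fun hl => h (List.nodup_cons.2 ⟨ha, hl⟩)), mul_zero]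

theorem xi_eq_lp (a : Fin n) : xi K n a = lp K [a] := by simp [lp_cons]

theorem ι_eq_sum_xi (v : Fin n → K) : ExteriorAlgebra.ι K v = ∑ i, v i • xi K n i := by
  conv_lhs => rw [pi_eq_sum_univ' v]
  simp only [map_sum, map_smul, xi]

theorem span_lp : Submodule.span K (Set.range (lp K (n := n))) = ⊤ := by
  refine eq_top_iff.2 fun f _ => ?_
  have hmul : ∀ a b : Grassmann K n, a ∈ Submodule.span K (Set.range (lp K (n := n))) →
      b ∈ Submodule.span K (Set.range (lp K (n := n))) →
      a * b ∈ Submodule.span K (Set.range (lp K (n := n))) := by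
    intro a b ha hb
    have := Submodule.mul_mem_mul ha hb
    rw [Submodule.span_mul_span] at this
    refine Submodule.span_mono ?_ this
    rintro _ ⟨_, ⟨l, rfl⟩, _, ⟨l', rfl⟩, rfl⟩
    exact ⟨l ++ l', lp_append l l'⟩
  induction f using ExteriorAlgebra.induction with
  | algebraMap r =>
    rw [Algebra.algebraMap_eq_smul_one]
    exact Submodule.smul_mem _ _ (Submodule.subset_span ⟨[], rfl⟩)
  | ι v =>
    rw [ι_eq_sum_xi]
    exact sum_mem fun i _ => Submodule.smul_mem _ _ (Submodule.subset_span ⟨[i], (xi_eq_lp i).symm⟩)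
  | mul a b ha hb => exact hmul a b (ha trivial) (hb trivial)
  | add a b ha hb => exact add_mem (ha trivial) (hb trivial)

/-- Induction over `Λ(n)` along products of generators. -/
theorem lp_induction {P : Grassmann K n → Prop} (f : Grassmann K n) (h : ∀ l, P (lp K l))
    (h0 : P 0) (hadd : ∀ a b, P a → P b → P (a + b)) (hsmul : ∀ (c : K) a, P a → P (c • a)) :
    P f := by
  have hf : f ∈ Submodule.span K (Set.range (lp K (n := n))) := by rw [span_lp]; trivial
  induction hf using Submodule.span_induction with
  | mem x hx => obtain ⟨l, rfl⟩ := hx; exact h l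
  | zero => exact h0
  | add a b _ _ ha hb => exact hadd a b ha hb
  | smul c a _ ha => exact hsmul c a ha

theorem xi_mem (i : Fin n) : xi K n i ∈ parity K n 1 := CliffordAlgebra.ι_mem_evenOdd_one _ _

theorem mul_mem_parity {p q : ZMod 2} {f g : Grassmann K n} (hf : f ∈ parity K n p)
    (hg : g ∈ parity K n q) : f * g ∈ parity K n (p + q) := SetLike.mul_mem_graded hf hg

theorem one_mem_parity : (1 : Grassmann K n) ∈ parity K n 0 := SetLike.one_mem_graded _

theorem lp_mem (l : List (Fin n)) : lp K l ∈ parity K n (l.length : ZMod 2) := by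
  induction l with
  | nil => simpa using one_mem_parity
  | cons a l ih =>
    rw [lp_cons, List.length_cons, Nat.cast_add, Nat.cast_one, add_comm]
    exact mul_mem_parity (xi_mem a) ih

theorem lp_mem_of_even {l : List (Fin n)} (h : Even l.length) : lp K l ∈ parity K n 0 := by
  have := lp_mem (K := K) l
  rwa [(ZMod.natCast_eq_zero_iff_even).2 h] at this

theorem lp_mem_of_odd {l : List (Fin n)} (h : Odd l.length) : lp K l ∈ parity K n 1 := by
  have := lp_mem (K := K) l
  rwa [(ZMod.natCast_eq_one_iff_odd).2 h] at this

theorem zmod_two (p : ZMod 2) : p = 0 ∨ p = 1 := by revert p; decide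

/-- For the zero quadratic form all vectors are orthogonal, and orthogonal parts of a Clifford
algebra supercommute. -/
theorem super_comm {p q : ZMod 2} {f g : Grassmann K n} (hf : f ∈ parity K n p)
    (hg : g ∈ parity K n q) : f * g = (-1 : K) ^ (p.val * q.val) • (g * f) := by
  have h := CliffordAlgebra.map_mul_map_of_isOrtho_of_mem_evenOdd
    (QuadraticMap.Isometry.id (0 : QuadraticForm K (Fin n → K)))
    (QuadraticMap.Isometry.id (0 : QuadraticForm K (Fin n → K)))
    (fun x y => by simp [QuadraticMap.IsOrtho]) f g hf hg
  rw [CliffordAlgebra.map_id] at h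
  simp only [AlgHom.id_apply] at h
  rw [h]
  rcases zmod_two p with rfl | rfl <;> rcases zmod_two q with rfl | rfl <;>
    simp [ZMod.val_one]

theorem involute_of_mem {p : ZMod 2} {f : Grassmann K n} (hf : f ∈ parity K n p) :
    CliffordAlgebra.involute f = (-1 : K) ^ p.val • f := by
  rcases zmod_two p with rfl | rfl
  · simpa using CliffordAlgebra.involute_eq_of_mem_even hf
  · simpa [ZMod.val_one] using CliffordAlgebra.involute_eq_of_mem_odd hf

theorem pd_xi_mul (i a : Fin n) (f : Grassmann K n) :
    pd K n i (xi K n a * f) = (if a = i then f else 0) - xi K n a * pd K n i f := by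
  have := CliffordAlgebra.contractLeft_ι_mul (Q := (0 : QuadraticForm K (Fin n → K)))
    (d := LinearMap.proj i) (Pi.single a 1) f
  refine this.trans ?_
  simp [Pi.single_apply, eq_comm, pd, xi]

@[simp] theorem pd_one (i : Fin n) : pd K n i 1 = 0 := CliffordAlgebra.contractLeft_one _ _

theorem pd_xi (i a : Fin n) : pd K n i (xi K n a) = if a = i then 1 else 0 := by
  simpa using pd_xi_mul i a (1 : Grassmann K n)

theorem pd_comm (i j : Fin n) (f : Grassmann K n) :
    pd K n i (pd K n j f) = -pd K n j (pd K n i f) := CliffordAlgebra.contractLeft_comm _ _ _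

theorem involute_lp_cons (a : Fin n) (l : List (Fin n)) :
    CliffordAlgebra.involute (lp K (a :: l)) = -(xi K n a * CliffordAlgebra.involute (lp K l)) := by
  rw [lp_cons, map_mul]
  erw [CliffordAlgebra.involute_ι]
  rw [neg_mul]; rfl

theorem pd_mul (i : Fin n) (f g : Grassmann K n) :
    pd K n i (f * g) = pd K n i f * g + CliffordAlgebra.involute f * pd K n i g := by
  induction f using lp_induction with
  | h l =>
    induction l with
    | nil => simp
    | cons a l ih =>
      rw [involute_lp_cons, lp_cons, mul_assoc, pd_xi_mul, ih, pd_xi_mul]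
      simp only [sub_mul, mul_add, neg_mul, mul_assoc, ite_mul, zero_mul]
      abel
  | h0 => simp
  | hadd a b ha hb => simp only [add_mul, map_add, ha, hb]; abel
  | hsmul c a ha => simp [ha, smul_add]

theorem pd_mul_of_mem {p : ZMod 2} {f : Grassmann K n} (hf : f ∈ parity K n p) (i : Fin n)
    (g : Grassmann K n) :
    pd K n i (f * g) = pd K n i f * g + (-1 : K) ^ p.val • (f * pd K n i g) := by
  rw [pd_mul, involute_of_mem hf, smul_mul_assoc]

theorem pd_lp_of_notMem {i : Fin n} {l : List (Fin n)} (h : i ∉ l) : pd K n i (lp K l) = 0 := by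
  induction l with
  | nil => simp
  | cons a l ih =>
    simp only [List.mem_cons, not_or] at h
    rw [lp_cons, pd_xi_mul, if_neg (Ne.symm h.1), ih h.2]; simp

theorem pd_lp_cons_self {i : Fin n} {l : List (Fin n)} (h : i ∉ l) :
    pd K n i (lp K (i :: l)) = lp K l := by
  rw [lp_cons, pd_xi_mul, if_pos rfl, pd_lp_of_notMem h]; simp

theorem pd_mem {p : ZMod 2} {f : Grassmann K n} (hf : f ∈ parity K n p) (i : Fin n) :
    pd K n i f ∈ parity K n (p + 1) := by
  have e : ∀ (m : Fin n → K) (y : Grassmann K n), pd K n i (CliffordAlgebra.ι _ m * y) =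
      m i • y - CliffordAlgebra.ι _ m * pd K n i y :=
    fun m y => CliffordAlgebra.contractLeft_ι_mul (Q := (0 : QuadraticForm K (Fin n → K)))
      (d := LinearMap.proj i) m y
  have c1 : ∀ m, ∀ q, ∀ y ∈ parity K n q,
      CliffordAlgebra.ι (0 : QuadraticForm K (Fin n → K)) m * y ∈ parity K n (q + 1) :=
    fun m q y hy => add_comm 1 q ▸ mul_mem_parity (CliffordAlgebra.ι_mem_evenOdd_one _ m) hy
  have two : ∀ q : ZMod 2, q + 1 + 1 = q := by decide
  have step : ∀ m₁ m₂, ∀ x ∈ parity K n p, pd K n i x ∈ parity K n (p + 1) →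
      pd K n i (CliffordAlgebra.ι (0 : QuadraticForm K (Fin n → K)) m₁ *
        CliffordAlgebra.ι (0 : QuadraticForm K (Fin n → K)) m₂ * x) ∈ parity K n (p + 1) := by
    intro m₁ m₂ x hx h
    rw [mul_assoc, e, e]
    refine sub_mem (Submodule.smul_mem _ _ (c1 _ _ _ hx)) (c1 _ _ _ ?_)
    refine sub_mem (Submodule.smul_mem _ _ hx) ?_
    have := c1 m₂ _ _ h
    rwa [two] at this
  rcases zmod_two p with rfl | rfl
  · induction f, hf using CliffordAlgebra.even_induction with
    | algebraMap r =>
      rw [Algebra.algebraMap_eq_smul_one, map_smul, pd_one, smul_zero]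
      exact zero_mem _
    | add x y hx hy h1 h2 => rw [map_add]; exact add_mem h1 h2
    | ι_mul_ι_mul m₁ m₂ x hx h => exact step m₁ m₂ x hx h
  · induction f, hf using CliffordAlgebra.odd_induction with
    | ι w =>
      have h := e w 1
      rw [mul_one, pd_one, mul_zero, sub_zero] at h
      rw [h]
      exact Submodule.smul_mem _ _ one_mem_parity
    | add x y hx hy h1 h2 => rw [map_add]; exact add_mem h1 h2
    | ι_mul_ι_mul m₁ m₂ x hx h => exact step m₁ m₂ x hx h

end Grassmann

/-! ### Sub-Lie superalgebras and separation by eigenvalues -/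

section LieSuper

variable {K : Type*} [Field K] {n : ℕ}

/-- The superbracket as a bilinear map. -/
def sbL (p q : ZMod 2) : Gl K n →ₗ[K] Gl K n →ₗ[K] Gl K n :=
  LinearMap.mk₂ K (superBracket p q)
    (fun a b c => by simp only [superBracket, add_mul, mul_add, smul_add]; abel)
    (fun r a b => by
      simp only [superBracket, smul_mul_assoc, mul_smul_comm, smul_sub]; rw [smul_comm r])
    (fun a b c => by simp only [superBracket, add_mul, mul_add, smul_add]; abel)
    (fun r a b => by
      simp only [superBracket, smul_mul_assoc, mul_smul_comm, smul_sub]; rw [smul_comm r])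

theorem superBracket_eq (p q : ZMod 2) (D E : Gl K n) : superBracket p q D E = sbL p q D E := rfl

theorem parts_mem {M : Submodule K (Gl K n)} (hM : IsSubLieSuperalgebra M) {a b : Gl K n}
    (ha : a ∈ glParity K n 0) (hb : b ∈ glParity K n 1) (hab : a + b ∈ M) : a ∈ M ∧ b ∈ M := by
  rw [hM.graded] at hab
  obtain ⟨a', ha', b', hb', h⟩ := Submodule.mem_sup.1 hab
  have h1 : a' - a = b - b' := by rw [sub_eq_sub_iff_add_eq_add, h, add_comm]
  have h0 : a' - a = 0 :=
    glParity_disjoint (sub_mem ha'.2 ha) (h1 ▸ sub_mem hb hb'.2)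
  have h2 : b - b' = 0 := h1 ▸ h0
  rw [← sub_eq_zero.1 h0, sub_eq_zero.1 h2]
  exact ⟨ha'.1, hb'.1⟩

/-- Closure under the bracket is tested on all homogeneous elements of a span, not only on its
generators. The contribution of the generators of the wrong parity has both parities, hence is zero.
-/
theorem mem_span_of_parity {ι : Type*} {v : ι → Gl K n} {par : ι → ZMod 2}
    (hv : ∀ a, v a ∈ glParity K n (par a)) {p : ZMod 2} {D : Gl K n}
    (hD : D ∈ Submodule.span K (Set.range v)) (hp : D ∈ glParity K n p) :
    D ∈ Submodule.span K (v '' {a | par a = p}) := by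
  have hle : ∀ q, Submodule.span K (v '' {a | par a = q}) ≤ glParity K n q := by
    intro q
    rw [Submodule.span_le]
    rintro _ ⟨a, rfl, rfl⟩
    exact hv a
  have hsup : D ∈ Submodule.span K (v '' {a | par a = p}) ⊔
      Submodule.span K (v '' {a | par a = p + 1}) := by
    refine (?_ : Submodule.span K (Set.range v) ≤ _) hD
    rw [← Submodule.span_union, ← Set.image_union]
    refine Submodule.span_mono ?_
    rintro _ ⟨a, rfl⟩
    refine ⟨a, ?_, rfl⟩
    change par a = p ∨ par a = p + 1
    generalize par a = r
    clear * -
    revert r p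
    decide
  obtain ⟨a, ha, b, hb, rfl⟩ := Submodule.mem_sup.1 hsup
  have hb' : b ∈ glParity K n p := by
    have := sub_mem hp (hle p ha)
    rwa [add_sub_cancel_left] at this
  have hb0 : b = 0 := by
    have h2 := hle _ hb
    rcases zmod_two p with rfl | rfl
    · exact glParity_disjoint hb' (by simpa using h2)
    · exact glParity_disjoint h2 hb'
  rwa [hb0, add_zero]

/-- A span of homogeneous operators is a sub-Lie superalgebra if it contains their brackets. -/
theorem isSubLieSuperalgebra_span {ι : Type*} {v : ι → Gl K n} {par : ι → ZMod 2}
    (hv : ∀ a, v a ∈ glParity K n (par a))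
    (hb : ∀ a b, superBracket (par a) (par b) (v a) (v b) ∈ Submodule.span K (Set.range v)) :
    IsSubLieSuperalgebra (Submodule.span K (Set.range v)) where
  graded := by
    refine le_antisymm ?_ (sup_le inf_le_left inf_le_left)
    rw [Submodule.span_le]
    rintro _ ⟨a, rfl⟩
    have h := hv a
    have h' : v a ∈ Submodule.span K (Set.range v) := Submodule.subset_span ⟨a, rfl⟩
    rcases zmod_two (par a) with e | e <;> rw [e] at h
    · exact Submodule.mem_sup_left ⟨h', h⟩
    · exact Submodule.mem_sup_right ⟨h', h⟩
  bracket_mem := by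
    intro p q D hD E hE
    have hD' := mem_span_of_parity hv hD.1 hD.2
    have hE' := mem_span_of_parity hv hE.1 hE.2
    rw [superBracket_eq]
    clear hD hE
    induction hD', hE' using Submodule.span_induction₂ with
    | mem_mem x y hx hy =>
      obtain ⟨a, rfl, rfl⟩ := hx
      obtain ⟨b, rfl, rfl⟩ := hy
      rw [← superBracket_eq]
      exact hb a b
    | zero_left y hy => simp
    | zero_right y hy => simp
    | add_left x y z _ _ _ h1 h2 => simpa using add_mem h1 h2
    | add_right x y z _ _ _ h1 h2 => simpa using add_mem h1 h2
    | smul_left r x y _ _ h => simpa using Submodule.smul_mem _ r h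
    | smul_right r x y _ _ h => simpa using Submodule.smul_mem _ r h

theorem bracket_even_mem {M : Submodule K (Gl K n)} (hM : IsSubLieSuperalgebra M) {h D : Gl K n}
    (hh : h ∈ M) (h0 : h ∈ glParity K n 0) (hD : D ∈ M) : h * D - D * h ∈ M := by
  rw [hM.graded] at hD
  obtain ⟨a, ha, b, hb, rfl⟩ := Submodule.mem_sup.1 hD
  have h1 := hM.bracket_mem 0 0 h ⟨hh, h0⟩ a ha
  have h2 := hM.bracket_mem 0 1 h ⟨hh, h0⟩ b hb
  simp only [superBracket, ZMod.val_zero, zero_mul, pow_zero, one_smul] at h1 h2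
  convert add_mem h1 h2 using 1
  rw [mul_add, add_mul]; abel

/-- The components of a sum of eigenvectors with distinct eigenvalues lie in every invariant
subspace that contains the sum. -/
theorem eigen_component_mem {V ι : Type*} [AddCommGroup V] [Module K V] (T : Module.End K V)
    {M : Submodule K V} (hT : ∀ x ∈ M, T x ∈ M) (Q : Finset ι) (v : ι → V) (w : ι → K)
    (hv : ∀ q ∈ Q, T (v q) = w q • v q) (hw : Set.InjOn w Q) (hs : ∑ q ∈ Q, v q ∈ M) :
    ∀ q ∈ Q, v q ∈ M := by
  classical
  intro q hq
  -- The factors T - w_s, s ∈ R, keep the sum inside M. For R = Q \ {q} only the component at q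
  -- survives, with a nonzero coefficient.
  have key : ∀ R : Finset ι, R ⊆ Q →
      ∑ r ∈ Q, (∏ s ∈ R, (w r - w s)) • v r ∈ M := by
    intro R
    induction R using Finset.induction_on with
    | empty => intro _; simpa using hs
    | insert a R ha ih =>
      intro hR
      have h := ih (fun x hx => hR (Finset.mem_insert_of_mem hx))
      convert sub_mem (hT _ h) (Submodule.smul_mem M (w a) h) using 1
      rw [map_sum, Finset.smul_sum, ← Finset.sum_sub_distrib]
      refine Finset.sum_congr rfl fun r hr => ?_
      rw [map_smul, hv r hr, Finset.prod_insert ha]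
      module
  have h := key (Q.erase q) (Finset.erase_subset _ _)
  rw [Finset.sum_eq_single_of_mem q hq] at h
  · refine (Submodule.smul_mem_iff M ?_).1 h
    refine Finset.prod_ne_zero_iff.2 fun s hs => ?_
    have := Finset.mem_erase.1 hs
    exact sub_ne_zero.2 fun e => this.1 (hw hq this.2 e).symm
  · intro r hr hrq
    rw [Finset.prod_eq_zero (Finset.mem_erase.2 ⟨hrq, hr⟩) (sub_self _), zero_smul]

/-- A sub-Lie superalgebra is generated by `h + ∑ v_q` if it is generated by the even element `h`
and the odd eigenvectors `v_q` of `ad h`, with distinct eigenvalues. -/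
theorem isGeneratedByOne_of_eigenvectors {ι : Type*} {L : Submodule K (Gl K n)}
    (hL : IsSubLieSuperalgebra L) {h : Gl K n} (hh : h ∈ L) (h0 : h ∈ glParity K n 0)
    (Q : Finset ι) (v : ι → Gl K n) (w : ι → K) (hvL : ∀ q ∈ Q, v q ∈ L)
    (hv1 : ∀ q ∈ Q, v q ∈ glParity K n 1) (hv : ∀ q ∈ Q, h * v q - v q * h = w q • v q)
    (hw : Set.InjOn w Q)
    (hgen : ∀ M, IsSubLieSuperalgebra M → h ∈ M → (∀ q ∈ Q, v q ∈ M) → L ≤ M) :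
    IsGeneratedByOne L := by
  refine ⟨h + ∑ q ∈ Q, v q, add_mem hh (sum_mem hvL), le_antisymm ?_ ?_⟩
  · exact sInf_le ⟨hL, by simpa using add_mem hh (sum_mem hvL)⟩
  · refine le_sInf ?_
    rintro M ⟨hM, hx⟩
    obtain ⟨m0, m1⟩ := parts_mem hM h0 (sum_mem hv1) (hx rfl)
    refine hgen M hM m0 ?_
    exact eigen_component_mem (LinearMap.mulLeft K h - LinearMap.mulRight K h)
      (fun x hx => bracket_even_mem hM m0 h0 hx) Q v w hv hw m1

end LieSuper

/-! ### Brackets of vector fields -/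

section VectorFields

variable {K : Type*} [Field K] {n : ℕ}

/-- `f ↦ f ∂/∂ξ_i` as a linear map. -/
def vfL (i : Fin n) : Grassmann K n →ₗ[K] Gl K n where
  toFun f := vf f i
  map_add' f g := LinearMap.ext fun x => by simp [vf, add_mul]
  map_smul' c f := LinearMap.ext fun x => by simp [vf]

theorem vfL_apply (i : Fin n) (f : Grassmann K n) : vfL i f = vf f i := rfl

theorem vf_apply (f : Grassmann K n) (i : Fin n) (g : Grassmann K n) :
    vf f i g = f * pd K n i g := rfl

/-- The vector field `∑ F_k ∂/∂ξ_k`. -/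
def fld : (Fin n → Grassmann K n) →ₗ[K] Gl K n := ∑ k, vfL k ∘ₗ LinearMap.proj k

theorem fld_eq (F : Fin n → Grassmann K n) : fld F = ∑ k, vf (F k) k := by
  simp [fld, vfL_apply]

theorem fld_apply (F : Fin n → Grassmann K n) (g : Grassmann K n) :
    fld F g = ∑ k, F k * pd K n k g := by
  simp [fld_eq, vf_apply]

theorem fld_xi (F : Fin n → Grassmann K n) (k : Fin n) : fld F (xi K n k) = F k := by
  simp [fld_apply, pd_xi]

theorem vf_eq_fld (f : Grassmann K n) (i : Fin n) : vf f i = fld (Pi.single i f) := by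
  rw [fld_eq, Finset.sum_eq_single_of_mem i (Finset.mem_univ _)]
  · simp
  · intro k _ hk
    rw [Pi.single_eq_of_ne hk, ← vfL_apply, map_zero]

theorem parity_add (p j : ZMod 2) : p + 1 + (j + 1) = j + p := by revert p j; decide

theorem vf_mem {p : ZMod 2} {f : Grassmann K n} (hf : f ∈ parity K n (p + 1)) (i : Fin n) :
    vf f i ∈ glParity K n p := by
  intro j g hg
  have := mul_mem_parity hf (pd_mem hg i)
  rwa [show p + 1 + (j + 1) = j + p from parity_add p j] at this

theorem fld_mem {p : ZMod 2} {F : Fin n → Grassmann K n} (hF : ∀ k, F k ∈ parity K n (p + 1)) :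
    fld F ∈ glParity K n p := by
  rw [fld_eq]
  exact sum_mem fun k _ => vf_mem (hF k) k

/-- The second-order terms cancel, since coefficients supercommute and the ∂'s anticommute. -/
theorem superBracket_vf {p q : ZMod 2} {f g : Grassmann K n} (hf : f ∈ parity K n (p + 1))
    (hg : g ∈ parity K n (q + 1)) (i j : Fin n) :
    superBracket p q (vf f i) (vf g j) =
      vf (f * pd K n i g) j - (-1 : K) ^ (p.val * q.val) • vf (g * pd K n j f) i := by
  refine LinearMap.ext fun x => ?_
  have h := super_comm hf hg
  simp only [superBracket, LinearMap.sub_apply, Module.End.mul_apply, LinearMap.smul_apply,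
    vf_apply, pd_mul_of_mem hf, pd_mul_of_mem hg, mul_add, mul_smul_comm, ← mul_assoc, h,
    pd_comm j i x]
  rcases zmod_two p with rfl | rfl <;> rcases zmod_two q with rfl | rfl <;>
    simp [ZMod.val_one, show (1 + 1 : ZMod 2) = 0 from rfl]

theorem superBracket_fld {p q : ZMod 2} {F G : Fin n → Grassmann K n}
    (hF : ∀ k, F k ∈ parity K n (p + 1)) (hG : ∀ k, G k ∈ parity K n (q + 1)) :
    superBracket p q (fld F) (fld G) =
      fld (fun k => fld F (G k) - (-1 : K) ^ (p.val * q.val) • fld G (F k)) := by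
  have h : ∀ i j, sbL p q (vf (F i) i) (vf (G j) j) = _ := fun i j =>
    (superBracket_eq _ _ _ _).symm.trans (superBracket_vf (hF i) (hG j) i j)
  rw [superBracket_eq, fld_eq F, fld_eq G, fld_eq]
  simp only [map_sum, LinearMap.sum_apply, h, Finset.sum_sub_distrib]
  simp only [← vfL_apply, map_sub, map_smul, map_sum, Finset.sum_sub_distrib,
    ← Finset.smul_sum]
  congr 2
  rw [Finset.sum_comm]
  rfl

theorem bracket_vf_mem {M : Submodule K (Gl K n)} (hM : IsSubLieSuperalgebra M) {p q : ZMod 2}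
    {f g : Grassmann K n} (hf : f ∈ parity K n p) (hg : g ∈ parity K n q) {i j : Fin n}
    (h1 : vf f i ∈ M) (h2 : vf g j ∈ M) :
    vf (f * pd K n i g) j - (-1 : K) ^ ((p + 1).val * (q + 1).val) • vf (g * pd K n j f) i ∈ M := by
  have two : ∀ q : ZMod 2, q + 1 + 1 = q := by decide
  have hf' : f ∈ parity K n (p + 1 + 1) := by rwa [two]
  have hg' : g ∈ parity K n (q + 1 + 1) := by rwa [two]
  rw [← superBracket_vf hf' hg']
  exact hM.bracket_mem _ _ _ ⟨h1, vf_mem hf' i⟩ _ ⟨h2, vf_mem hg' j⟩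

theorem bracket_vf_mem_left {M : Submodule K (Gl K n)} (hM : IsSubLieSuperalgebra M)
    {p q : ZMod 2} {f g : Grassmann K n} (hf : f ∈ parity K n p) (hg : g ∈ parity K n q)
    {i j : Fin n} (h1 : vf f i ∈ M) (h2 : vf g j ∈ M) (h : g * pd K n j f = 0) :
    vf (f * pd K n i g) j ∈ M := by
  have := bracket_vf_mem hM hf hg h1 h2
  rwa [h, ← vfL_apply i, map_zero, smul_zero, sub_zero] at this

end VectorFields

/-! ### Diagonal fields and their eigenvectors -/

section Euler

variable {K : Type*} [Field K] {n : ℕ}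

/-- The diagonal vector field `∑ a_k ξ_k ∂/∂ξ_k`. -/
def eul (a : Fin n → K) : Gl K n := fld fun k => a k • xi K n k

theorem eul_mem (a : Fin n → K) : eul a ∈ glParity K n 0 :=
  fld_mem fun k => Submodule.smul_mem _ _ (by simpa using xi_mem k)

theorem eul_lp (a : Fin n → K) (l : List (Fin n)) :
    eul a (lp K l) = (l.map a).sum • lp K l := by
  induction l with
  | nil => simp [eul, fld_apply]
  | cons b l ih =>
    rw [eul, fld_apply] at ih ⊢
    have : ∀ k, a k • xi K n k * pd K n k (lp K (b :: l)) =
        (if b = k then a k • (xi K n k * lp K l) else 0) +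
          xi K n b * (a k • xi K n k * pd K n k (lp K l)) := by
      intro k
      rw [lp_cons, pd_xi_mul, mul_sub]
      simp only [smul_mul_assoc, mul_smul_comm]
      rw [xi_mul_xi_mul_comm k b]
      split_ifs <;> simp
    rw [Finset.sum_congr rfl fun k _ => this k, Finset.sum_add_distrib, ← Finset.mul_sum, ih]
    simp [lp_cons, add_smul]

theorem eul_mono (a : Fin n → K) (u : Finset (Fin n)) :
    eul a (mono K n u) = (∑ k ∈ u, a k) • mono K n u := by
  rw [mono_eq_lp, eul_lp]
  congr 1
  rw [← Finset.sum_map_toList, (u.sort_perm_toList (· ≤ ·)).map a |>.sum_eq]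

theorem eul_bracket (a : Fin n → K) {q : ZMod 2} {G : Fin n → Grassmann K n}
    (hG : ∀ k, G k ∈ parity K n (q + 1)) {w : K}
    (h : ∀ k, eul a (G k) = (w + a k) • G k) :
    eul a * fld G - fld G * eul a = w • fld G := by
  have h1 := superBracket_fld (p := 0) (q := q) (F := fun k => a k • xi K n k) (G := G)
    (fun k => Submodule.smul_mem _ _ (by simpa using xi_mem k)) hG
  simp only [superBracket, ZMod.val_zero, zero_mul, pow_zero, one_smul, map_smul, fld_xi] at h1
  refine h1.trans ?_
  rw [← map_smul]
  congr 1
  funext k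
  change eul a (G k) - _ = w • G k
  rw [h]; module

theorem eul_bracket_vf (a : Fin n → K) {q : ZMod 2} {f : Grassmann K n}
    (hf : f ∈ parity K n (q + 1)) {w : K} (i : Fin n) (h : eul a f = w • f) :
    eul a * vf f i - vf f i * eul a = (w - a i) • vf f i := by
  rw [vf_eq_fld]
  refine eul_bracket a (q := q) (fun k => ?_) fun k => ?_ <;> by_cases hk : k = i
  · subst hk; simpa using hf
  · rw [Pi.single_eq_of_ne hk]; exact zero_mem _
  · subst hk; simp [h]
  · rw [Pi.single_eq_of_ne hk, map_zero, smul_zero]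

/-- This is the relation [eul a, ∂_i] = -a_i ∂_i evaluated at f. -/
theorem eul_pd (a : Fin n → K) (i : Fin n) (f : Grassmann K n) {w : K} (h : eul a f = w • f) :
    eul a (pd K n i f) = (w - a i) • pd K n i f := by
  have h1 := eul_bracket_vf a (q := 1) (w := 0) (f := 1) one_mem_parity i
    (by simp [eul, fld_apply])
  have h2 := LinearMap.congr_fun h1 f
  simp only [LinearMap.sub_apply, Module.End.mul_apply, vf_apply, one_mul, h, map_smul,
    LinearMap.smul_apply] at h2
  rw [sub_eq_iff_eq_add.1 h2]
  module

end Euler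

/-! ### Generic diagonal coefficients -/

section Generic

/-- Uniqueness of expansions in base B + 1: the lowest digit is divisible by B + 1 and at most B in
absolute value, hence zero. -/
theorem int_digits (B : ℕ) (m : ℕ) (d : Fin m → ℤ) (hd : ∀ k, |d k| ≤ B)
    (h : ∑ k, d k * ((B : ℤ) + 1) ^ (k : ℕ) = 0) : d = 0 := by
  induction m with
  | zero => exact Subsingleton.elim _ _
  | succ m ih =>
    rw [Fin.sum_univ_succ] at h
    simp only [Fin.val_zero, pow_zero, mul_one, Fin.val_succ, pow_succ, ← mul_assoc,
      ← Finset.sum_mul] at h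
    have h0 : d 0 = 0 := by
      refine Int.eq_zero_of_abs_lt_dvd (m := (B : ℤ) + 1)
        ⟨-∑ k : Fin m, d k.succ * ((B : ℤ) + 1) ^ (k : ℕ), ?_⟩ ?_
      · linarith
      · have := hd 0; omega
    rw [h0, zero_add] at h
    have h' := (mul_eq_zero.1 h).resolve_right (by positivity)
    have := ih (fun k => d k.succ) (fun k => hd _) h'
    funext k
    refine Fin.cases h0 (fun k => congrFun this k) k

variable (K : Type*) [Field K] [CharZero K]

theorem exists_digits (B m : ℕ) : ∃ b : Fin m → K, ∀ d : Fin m → ℤ, (∀ k, |d k| ≤ B) →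
    ∑ k, (d k : K) * b k = 0 → d = 0 := by
  refine ⟨fun k => ((B : K) + 1) ^ (k : ℕ), fun d hd h => int_digits B m d hd ?_⟩
  have h' : ((∑ k, d k * ((B : ℤ) + 1) ^ (k : ℕ) : ℤ) : K) = 0 := by
    push_cast; exact h
  exact_mod_cast h'

/-- Coefficients with sum zero satisfying no other small integer relation. -/
theorem exists_traceless (n : ℕ) : ∃ a : Fin n → K, ∑ k, a k = 0 ∧
    ∀ d : Fin n → ℤ, (∀ k, |d k| ≤ 2) → ∑ k, (d k : K) * a k = 0 → ∀ i j, d i = d j := by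
  -- A relation ∑ d_k a_k = 0 becomes ∑ (n d_k - ∑ d_j) b_k = 0, whose coefficients are at most 2n +
  -- 2n in absolute value. So n d_k = ∑ d_j for every k.
  obtain ⟨b, hb⟩ := exists_digits K (4 * n) n
  refine ⟨fun k => n * b k - ∑ j, b j, ?_, fun d hd h => ?_⟩
  · simp [Finset.sum_sub_distrib, ← Finset.mul_sum]
  · have habs : |∑ k, d k| ≤ 2 * n := by
      refine (Finset.abs_sum_le_sum_abs _ _).trans ?_
      refine (Finset.sum_le_sum fun k _ => hd k).trans ?_
      simp [mul_comm]
    have := hb (fun k => n * d k - ∑ j, d j) (fun k => ?_) ?_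
    · intro i j
      have hi : n * d i - ∑ j, d j = 0 := congrFun this i
      have hj : n * d j - ∑ j, d j = 0 := congrFun this j
      have hn : (n : ℤ) ≠ 0 := by have := i.pos; omega
      exact mul_left_cancel₀ hn (by linarith)
    · have h1 : |(n : ℤ) * d k| ≤ n * 2 := by
        rw [abs_mul, Nat.abs_cast]
        exact mul_le_mul_of_nonneg_left (hd k) (by positivity)
      have := abs_sub ((n : ℤ) * d k) (∑ j, d j)
      push_cast
      linarith
    · rw [← h]
      push_cast
      simp only [sub_mul, mul_sub, Finset.sum_sub_distrib, ← Finset.mul_sum, ← Finset.sum_mul]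
      rw [Finset.mul_sum]
      congr 1
      refine Finset.sum_congr rfl fun k _ => by ring

/-- Coefficients changing sign under an involution without further small integer relations. -/
theorem exists_antisymmetric {n : ℕ} (σ : Fin n → Fin n) (hσ : Function.Involutive σ) :
    ∃ a : Fin n → K, (∀ k, a (σ k) = -a k) ∧ ∀ d : Fin n → ℤ, (∀ k, |d k| ≤ 1) →
      ∑ k, (d k : K) * a k = 0 → ∀ k, d k = d (σ k) := by
  -- Reindexing by σ turns ∑ d_k a_k into ∑ (d_k - d_{σ k}) b_k, with coefficients of absolute value
  -- at most 2.
  obtain ⟨b, hb⟩ := exists_digits K 2 n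
  refine ⟨fun k => b k - b (σ k), fun k => by simp [hσ k], fun d hd h => ?_⟩
  have := hb (fun k => d k - d (σ k)) (fun k => ?_) ?_
  · intro k
    exact sub_eq_zero.1 (congrFun this k)
  · have := abs_sub (d k) (d (σ k))
    have := hd k
    have := hd (σ k)
    push_cast
    linarith
  · rw [← h]
    push_cast
    simp only [sub_mul, mul_sub, Finset.sum_sub_distrib]
    congr 1
    refine Fintype.sum_equiv hσ.toPerm _ _ fun k => ?_
    simp [hσ k]

end Generic

/-! ### Closure of W(n) and S(n) under the bracket -/

section Closure

variable {K : Type*} [Field K] {n : ℕ}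

theorem fld_xi_mem {p : ZMod 2} {D : Gl K n} (hD : D ∈ glParity K n p) (k : Fin n) :
    D (xi K n k) ∈ parity K n (p + 1) := add_comm 1 p ▸ hD 1 _ (xi_mem k)

/-- A superderivation is determined by the images of the generators. -/
theorem superDer_eq_fld {p : ZMod 2} {D : Gl K n} (hD : D ∈ superDer K n p) :
    D = fld fun k => D (xi K n k) := by
  have h1 : D 1 = 0 := by
    have := hD.2 0 1 one_mem_parity 1
    simpa using this
  refine LinearMap.ext fun f => ?_
  induction f using lp_induction with
  | h l =>
    induction l with
    | nil => simp [h1, fld_apply]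
    | cons a l ih =>
      rw [lp_cons, hD.2 1 _ (xi_mem a), ih, fld_apply, fld_apply]
      have : ∀ k, D (xi K n k) * pd K n k (xi K n a * lp K l) =
          (if a = k then D (xi K n k) * lp K l else 0) + (-1 : K) ^ (p.val * (1 : ZMod 2).val) •
            (xi K n a * (D (xi K n k) * pd K n k (lp K l))) := by
        intro k
        rw [pd_xi_mul, mul_sub, ← mul_assoc _ (xi K n a), super_comm (fld_xi_mem hD.1 k) (xi_mem a),
          smul_mul_assoc, mul_assoc]
        rcases zmod_two p with rfl | rfl <;>
          simp [ZMod.val_one, show (1 + 1 : ZMod 2) = 0 from rfl, sub_eq_add_neg]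
      rw [Finset.sum_congr rfl fun k _ => this k, Finset.sum_add_distrib, ← Finset.smul_sum,
        ← Finset.mul_sum]
      simp
  | h0 => simp
  | hadd a b ha hb => rw [map_add, map_add, ha, hb]
  | hsmul c a ha => rw [map_smul, map_smul, ha]

theorem vf_mem_superDer {p : ZMod 2} {f : Grassmann K n} (hf : f ∈ parity K n (p + 1))
    (i : Fin n) : vf f i ∈ superDer K n p := by
  refine ⟨vf_mem hf i, fun j g hg x => ?_⟩
  rw [vf_apply, vf_apply, vf_apply, pd_mul_of_mem hg, mul_add, mul_smul_comm, ← mul_assoc f g,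
    super_comm hf hg, ← mul_assoc, smul_mul_assoc, mul_assoc g]
  congr 1
  rw [smul_smul]
  congr 1
  rcases zmod_two p with rfl | rfl <;> rcases zmod_two j with rfl | rfl <;>
    simp [ZMod.val_one, show (1 + 1 : ZMod 2) = 0 from rfl]

theorem two_cancel (p : ZMod 2) : p + 1 + 1 = p := by revert p; decide

theorem vf_lp_mem (l : List (Fin n)) (i : Fin n) :
    vf (lp K l) i ∈ glParity K n (l.length + 1) :=
  vf_mem ((two_cancel (l.length : ZMod 2)).symm ▸ lp_mem l) i

theorem W_eq_span : W K n = Submodule.span K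
    (Set.range fun x : List (Fin n) × Fin n => vf (lp K x.1) x.2) := by
  refine le_antisymm ?_ ?_
  · have key : ∀ p, superDer K n p ≤ Submodule.span K
        (Set.range fun x : List (Fin n) × Fin n => vf (lp K x.1) x.2) := by
      intro p D hD
      rw [superDer_eq_fld hD, fld_eq]
      refine sum_mem fun k _ => ?_
      generalize D (xi K n k) = f
      rw [← vfL_apply]
      induction f using lp_induction with
      | h l => exact Submodule.subset_span ⟨(l, k), rfl⟩
      | h0 => rw [map_zero]; exact zero_mem _
      | hadd a b ha hb => rw [map_add]; exact add_mem ha hb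
      | hsmul c a ha => rw [map_smul]; exact Submodule.smul_mem _ _ ha
    exact sup_le (key 0) (key 1)
  · rw [Submodule.span_le]
    rintro _ ⟨⟨l, i⟩, rfl⟩
    have h := vf_mem_superDer (p := l.length + 1) (f := lp K l)
      ((two_cancel (l.length : ZMod 2)).symm ▸ lp_mem l) i
    rcases zmod_two ((l.length : ZMod 2) + 1) with e | e <;> rw [e] at h
    · exact Submodule.mem_sup_left h
    · exact Submodule.mem_sup_right h

theorem vf_mem_W (f : Grassmann K n) (i : Fin n) : vf f i ∈ W K n := by
  rw [W_eq_span, ← vfL_apply]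
  induction f using lp_induction with
  | h l => exact Submodule.subset_span ⟨(l, i), rfl⟩
  | h0 => rw [map_zero]; exact zero_mem _
  | hadd a b ha hb => rw [map_add]; exact add_mem ha hb
  | hsmul c a ha => rw [map_smul]; exact Submodule.smul_mem _ _ ha

theorem fld_mem_W (F : Fin n → Grassmann K n) : fld F ∈ W K n := by
  rw [fld_eq]; exact sum_mem fun k _ => vf_mem_W _ _

theorem isSubLieSuperalgebra_W : IsSubLieSuperalgebra (W K n) := by
  have h := W_eq_span (K := K) (n := n)
  rw [h]
  refine isSubLieSuperalgebra_span (par := fun x => x.1.length + 1)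
    (fun x => vf_lp_mem x.1 x.2) fun x y => ?_
  rw [superBracket_vf ((two_cancel _).symm ▸ lp_mem x.1) ((two_cancel _).symm ▸ lp_mem y.1), ← h]
  exact sub_mem (vf_mem_W _ _) (Submodule.smul_mem _ _ (vf_mem_W _ _))

/-- `D_ij` as a linear map. -/
def DijL (i j : Fin n) : Grassmann K n →ₗ[K] Gl K n := vfL j ∘ₗ pd K n i + vfL i ∘ₗ pd K n j

theorem DijL_apply (i j : Fin n) (f : Grassmann K n) : DijL i j f = Dij i j f := rfl

/-- The coefficients of the vector field `D_ij(f)`. -/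
def dijCoeff (i j : Fin n) (f : Grassmann K n) : Fin n → Grassmann K n :=
  Pi.single j (pd K n i f) + Pi.single i (pd K n j f)

theorem Dij_eq_fld (i j : Fin n) (f : Grassmann K n) : Dij i j f = fld (dijCoeff i j f) := by
  rw [dijCoeff, map_add, ← vf_eq_fld, ← vf_eq_fld]; rfl

theorem map_single_mem {N : Submodule K (Grassmann K n)} {i : Fin n} {f : Grassmann K n}
    (hf : f ∈ N) (k : Fin n) : (Pi.single i f : Fin n → Grassmann K n) k ∈ N := by
  by_cases hk : k = i
  · subst hk; simpa using hf
  · rw [Pi.single_eq_of_ne hk]; exact zero_mem _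

theorem dijCoeff_mem {N : Submodule K (Grassmann K n)} {i j : Fin n} {f : Grassmann K n}
    (hi : pd K n i f ∈ N) (hj : pd K n j f ∈ N) (k : Fin n) : dijCoeff i j f k ∈ N :=
  add_mem (map_single_mem hi k) (map_single_mem hj k)

theorem sum_pd_single (i : Fin n) (f : Grassmann K n) :
    ∑ k, pd K n k ((Pi.single i f : Fin n → Grassmann K n) k) = pd K n i f := by
  rw [Finset.sum_eq_single_of_mem i (Finset.mem_univ _)]
  · simp
  · intro k _ hk
    rw [Pi.single_eq_of_ne hk, map_zero]

/-- As ∂_i and ∂_j anticommute, the fields D_ij(f) are divergence-free, which is what closes S(n)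
under the bracket. -/
theorem div_dijCoeff (i j : Fin n) (f : Grassmann K n) :
    ∑ k, pd K n k (dijCoeff i j f k) = 0 := by
  simp only [dijCoeff, Pi.add_apply, map_add, Finset.sum_add_distrib, sum_pd_single]
  rw [pd_comm, neg_add_cancel]

theorem sign_identity {V : Type*} [AddCommGroup V] [Module K V] (p q : ZMod 2) (x y : V) :
    x - (-1 : K) ^ (p.val * q.val) • y = (-1 : K) ^ (p + 1).val •
      ((-1 : K) ^ (p + 1).val • x + (-1 : K) ^ (p.val * (q + 1).val) • y) := by
  rcases zmod_two p with rfl | rfl <;> rcases zmod_two q with rfl | rfl <;>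
    simp [ZMod.val_one, show (1 + 1 : ZMod 2) = 0 from rfl, sub_eq_add_neg]

/-- The bracket of two divergence-free fields in terms of the operators `D_ij`. -/
theorem superBracket_eq_sum_Dij {p q : ZMod 2} {F G : Fin n → Grassmann K n}
    (hF : ∀ k, F k ∈ parity K n (p + 1)) (hG : ∀ k, G k ∈ parity K n (q + 1))
    (dF : ∑ k, pd K n k (F k) = 0) (dG : ∑ k, pd K n k (G k) = 0) :
    superBracket p q (fld F) (fld G) =
      (-1 : K) ^ (p + 1).val • ∑ i, ∑ j, Dij i j (F i * G j) := by
  have e1 : ∑ i, ∑ j, vf (pd K n i (F i * G j)) j =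
      (-1 : K) ^ (p + 1).val • fld fun k => fld F (G k) := by
    rw [Finset.sum_comm, fld_eq, Finset.smul_sum]
    refine Finset.sum_congr rfl fun j _ => ?_
    simp only [← vfL_apply]
    rw [← map_sum, ← map_smul]
    congr 1
    simp only [pd_mul_of_mem (hF _), Finset.sum_add_distrib, ← Finset.sum_mul, dF, zero_mul,
      zero_add, fld_apply, Finset.smul_sum]
  have e2 : ∑ i, ∑ j, vf (pd K n j (F i * G j)) i =
      (-1 : K) ^ (p.val * (q + 1).val) • fld fun k => fld G (F k) := by
    rw [fld_eq, Finset.smul_sum]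
    refine Finset.sum_congr rfl fun i _ => ?_
    simp only [← vfL_apply]
    rw [← map_sum, ← map_smul]
    congr 1
    simp only [pd_mul_of_mem (hF _), Finset.sum_add_distrib, ← Finset.mul_sum, ← Finset.smul_sum,
      dG, mul_zero, smul_zero, add_zero, fld_apply]
    rw [Finset.smul_sum]
    refine Finset.sum_congr rfl fun j _ => ?_
    have := pd_mem (hF i) j
    rw [two_cancel] at this
    exact super_comm this (hG j)
  have e3 : ∑ i, ∑ j, Dij i j (F i * G j) = ∑ i, ∑ j, vf (pd K n i (F i * G j)) j +
      ∑ i, ∑ j, vf (pd K n j (F i * G j)) i := by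
    simp only [Dij, Finset.sum_add_distrib]
  have e4 : (fun k => fld F (G k) - (-1 : K) ^ (p.val * q.val) • fld G (F k)) =
      (fun k => fld F (G k)) - (-1 : K) ^ (p.val * q.val) • fun k => fld G (F k) := rfl
  rw [superBracket_fld hF hG, e3, e1, e2, e4, map_sub, map_smul]
  exact sign_identity p q _ _

theorem exists_lp_eq {l : List (Fin n)} (hl : l.Nodup) :
    lp K l = mono K n l.toFinset ∨ lp K l = -mono K n l.toFinset := by
  refine lp_perm (List.perm_of_nodup_nodup_toFinset_eq hl (Finset.sort_nodup _ _) ?_)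
  simp

theorem map_lp_mem_of_mono (φ : Grassmann K n →ₗ[K] Gl K n)
    {M : Submodule K (Gl K n)} {l : List (Fin n)}
    (h : l.Nodup → φ (mono K n l.toFinset) ∈ M) : φ (lp K l) ∈ M := by
  by_cases hl : l.Nodup
  · rcases exists_lp_eq (K := K) hl with e | e <;> rw [e]
    · exact h hl
    · rw [map_neg]; exact neg_mem (h hl)
  · rw [lp_of_not_nodup hl, map_zero]; exact zero_mem _

/-- Monomials with a repeated index vanish, so the bound |u| ≤ n is automatic and only the lower
bound c remains: 1 for S(n), 2 for the part of S̃(n) in degrees ≥ 0. -/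
theorem iSup_SComp_eq_span (c : ℕ) : ⨆ d ∈ Finset.Icc c n, SComp K n d = Submodule.span K
    (Set.range fun x : Fin n × Fin n × {l : List (Fin n) // c ≤ l.length} =>
      Dij x.1 x.2.1 (lp K x.2.2.1)) := by
  refine le_antisymm ?_ ?_
  · refine iSup₂_le fun d hd => ?_
    rw [SComp, Submodule.span_le]
    rintro _ ⟨i, j, u, rfl, rfl⟩
    refine Submodule.subset_span ⟨(i, j, ⟨u.sort (· ≤ ·), ?_⟩), rfl⟩
    rw [Finset.length_sort]
    exact (Finset.mem_Icc.1 hd).1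
  · rw [Submodule.span_le]
    rintro _ ⟨⟨i, j, l, hl⟩, rfl⟩
    refine map_lp_mem_of_mono (DijL i j) fun hn => ?_
    have hc : l.toFinset.card = l.length := List.toFinset_card_of_nodup hn
    refine Submodule.mem_iSup_of_mem l.length (Submodule.mem_iSup_of_mem ?_ ?_)
    · refine Finset.mem_Icc.2 ⟨hl, ?_⟩
      rw [← hc]
      simpa using Finset.card_le_univ l.toFinset
    · exact Submodule.subset_span ⟨i, j, _, hc, rfl⟩

theorem Dij_mem_S (i j : Fin n) (f : Grassmann K n) : Dij i j f ∈ S K n := by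
  rw [← DijL_apply]
  induction f using lp_induction with
  | h l =>
    rcases l with _ | ⟨a, l⟩
    · simp [DijL]
    · rw [S, iSup_SComp_eq_span]
      exact Submodule.subset_span ⟨(i, j, ⟨a :: l, by simp⟩), rfl⟩
  | h0 => rw [map_zero]; exact zero_mem _
  | hadd a b ha hb => rw [map_add]; exact add_mem ha hb
  | hsmul c a ha => rw [map_smul]; exact Submodule.smul_mem _ _ ha

theorem dijCoeff_lp_mem (i j : Fin n) (l : List (Fin n)) (k : Fin n) :
    dijCoeff i j (lp K l) k ∈ parity K n (l.length + 1) :=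
  dijCoeff_mem (pd_mem (lp_mem l) i) (pd_mem (lp_mem l) j) k

theorem isSubLieSuperalgebra_S : IsSubLieSuperalgebra (S K n) := by
  have h := iSup_SComp_eq_span (K := K) (n := n) 1
  change S K n = _ at h
  rw [h]
  refine isSubLieSuperalgebra_span (par := fun x => x.2.2.1.length) (fun x => ?_) fun x y => ?_
  · rw [Dij_eq_fld]
    exact fld_mem (dijCoeff_lp_mem _ _ _)
  · rw [Dij_eq_fld, Dij_eq_fld, superBracket_eq_sum_Dij (dijCoeff_lp_mem _ _ _)
      (dijCoeff_lp_mem _ _ _) (div_dijCoeff _ _ _) (div_dijCoeff _ _ _), ← h]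
    exact Submodule.smul_mem _ _ (sum_mem fun i _ => sum_mem fun j _ => Dij_mem_S _ _ _)

end Closure

/-! ### The degree filtration -/

section Filtration

variable {K : Type*} [Field K] {n : ℕ}

/-- The elements of `Λ(n)` of degree at least `d`. -/
def degGE (K : Type*) [Field K] (n d : ℕ) : Submodule K (Grassmann K n) :=
  Submodule.span K {f | ∃ l : List (Fin n), d ≤ l.length ∧ f = lp K l}

theorem lp_mem_degGE {d : ℕ} {l : List (Fin n)} (h : d ≤ l.length) : lp K l ∈ degGE K n d :=
  Submodule.subset_span ⟨l, h, rfl⟩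

theorem mul_mem_degGE {d e : ℕ} {f g : Grassmann K n} (hf : f ∈ degGE K n d)
    (hg : g ∈ degGE K n e) : f * g ∈ degGE K n (d + e) := by
  have h := Submodule.mul_mem_mul hf hg
  rw [degGE, degGE, Submodule.span_mul_span] at h
  refine Submodule.span_mono ?_ h
  rintro _ ⟨_, ⟨l, hl, rfl⟩, _, ⟨l', hl', rfl⟩, rfl⟩
  exact ⟨l ++ l', by rw [List.length_append]; omega, (lp_append l l').symm⟩

theorem pd_mem_degGE {d : ℕ} {f : Grassmann K n} (hf : f ∈ degGE K n (d + 1)) (i : Fin n) :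
    pd K n i f ∈ degGE K n d := by
  induction hf using Submodule.span_induction with
  | mem x hx =>
    obtain ⟨l, hl, rfl⟩ := hx
    induction l generalizing d with
    | nil => simp at hl
    | cons a l ih =>
      rw [List.length_cons, Nat.add_le_add_iff_right] at hl
      rw [lp_cons, pd_xi_mul]
      refine sub_mem ?_ ?_
      · split_ifs
        · exact lp_mem_degGE hl
        · exact zero_mem _
      · rcases d with _ | d
        · rcases l with _ | ⟨b, l⟩
          · simp
          · have := mul_mem_degGE (lp_mem_degGE (K := K) (le_refl [a].length))
              (ih (d := 0) (by simp))
            rw [← xi_eq_lp] at this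
            refine (?_ : degGE K n _ ≤ _) this
            exact Submodule.span_mono fun f ⟨l, _, e⟩ => ⟨l, by omega, e⟩
        · have := mul_mem_degGE (lp_mem_degGE (K := K) (le_refl [a].length)) (ih hl)
          rw [← xi_eq_lp, List.length_singleton, add_comm] at this
          exact this
  | zero => rw [map_zero]; exact zero_mem _
  | add a b _ _ ha hb => rw [map_add]; exact add_mem ha hb
  | smul c a _ ha => rw [map_smul]; exact Submodule.smul_mem _ _ ha

theorem eq_zero_of_mem_degGE {d : ℕ} (hd : n < d) {f : Grassmann K n} (hf : f ∈ degGE K n d) :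
    f = 0 := by
  have : degGE K n d ≤ ⊥ := by
    rw [degGE, Submodule.span_le]
    rintro _ ⟨l, hl, rfl⟩
    refine lp_of_not_nodup fun h => ?_
    have := h.length_le_card
    rw [Fintype.card_fin] at this
    omega
  exact this hf

theorem omega_mem_degGE : mono K n Finset.univ ∈ degGE K n n :=
  lp_mem_degGE (by simp)

theorem omega_mul {f : Grassmann K n} (hf : f ∈ degGE K n 1) : mono K n Finset.univ * f = 0 :=
  eq_zero_of_mem_degGE (by omega) (mul_mem_degGE omega_mem_degGE hf)

theorem pd_omega_mem (hn : 1 ≤ n) (i : Fin n) :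
    pd K n i (mono K n Finset.univ) ∈ degGE K n (n - 1) := by
  refine pd_mem_degGE ?_ i
  rw [Nat.sub_add_cancel hn]
  exact omega_mem_degGE

theorem dijCoeff_mem_degGE {d : ℕ} {f : Grassmann K n} (hf : f ∈ degGE K n (d + 1))
    (i j k : Fin n) : dijCoeff i j f k ∈ degGE K n d :=
  dijCoeff_mem (N := degGE K n d) (pd_mem_degGE hf i) (pd_mem_degGE hf j) k

end Filtration

/-! ### Closure of S̃(n) under the bracket -/

section STildeClosure

variable {K : Type*} [Field K] {n : ℕ}

theorem one_add_omega_mem (hn : Even n) : (1 + mono K n Finset.univ) ∈ parity K n 0 :=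
  add_mem one_mem_parity (lp_mem_of_even (by simpa using hn))

theorem one_add_omega_mem' (hn : Even n) :
    (1 + mono K n Finset.univ) ∈ parity K n (1 + 1) := one_add_omega_mem hn

theorem sign_swap {V : Type*} [AddCommGroup V] [Module K V] (p q : ZMod 2) (x y : V) :
    x - (-1 : K) ^ (p.val * q.val) • y =
      -((-1 : K) ^ (p.val * q.val) • (y - (-1 : K) ^ (q.val * p.val) • x)) := by
  rcases zmod_two p with rfl | rfl <;> rcases zmod_two q with rfl | rfl <;>
    simp [ZMod.val_one, sub_eq_add_neg, add_comm]

theorem sub_sign_one {V : Type*} [AddCommGroup V] [Module K V] (x y : V) :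
    x - (-1 : K) ^ ((1 : ZMod 2).val * (1 : ZMod 2).val) • y = x + y := by
  simp [ZMod.val_one]

theorem superBracket_swap (p q : ZMod 2) (D E : Gl K n) :
    superBracket p q D E = -((-1 : K) ^ (p.val * q.val) • superBracket q p E D) :=
  sign_swap p q _ _

theorem STilde_eq_span : STilde K n = Submodule.span K (Set.range (Sum.elim
    (fun j : Fin n => vf (1 + mono K n Finset.univ) j)
    (fun x : Fin n × Fin n × {l : List (Fin n) // 2 ≤ l.length} =>
      Dij x.1 x.2.1 (lp K x.2.2.1)))) := by
  rw [STilde, iSup_SComp_eq_span, ← Submodule.span_union, Set.Sum.elim_range]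

theorem vf_one_add_omega_mem (j : Fin n) : vf (1 + mono K n Finset.univ) j ∈ STilde K n :=
  Submodule.mem_sup_left (Submodule.subset_span ⟨j, rfl⟩)

theorem Dij_mem_STilde (i j : Fin n) {f : Grassmann K n} (hf : f ∈ degGE K n 2) :
    Dij i j f ∈ STilde K n := by
  rw [← DijL_apply]
  induction hf using Submodule.span_induction with
  | mem x hx =>
    obtain ⟨l, hl, rfl⟩ := hx
    rw [STilde_eq_span]
    exact Submodule.subset_span ⟨Sum.inr (i, j, ⟨l, hl⟩), rfl⟩
  | zero => rw [map_zero]; exact zero_mem _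
  | add a b _ _ ha hb => rw [map_add]; exact add_mem ha hb
  | smul c a _ ha => rw [map_smul]; exact Submodule.smul_mem _ _ ha

/-- The products G_k ω vanish by degree. Expanding ∑ ∂_k(G_k ω) = 0 leaves (div G) ω, which is zero,
and ± G(ω). -/
theorem fld_omega {q : ZMod 2} {G : Fin n → Grassmann K n} (hG : ∀ k, G k ∈ parity K n q)
    (h1 : ∀ k, G k ∈ degGE K n 1) (dG : ∑ k, pd K n k (G k) = 0) :
    fld G (mono K n Finset.univ) = 0 := by
  have h : ∑ k, pd K n k (G k * mono K n Finset.univ) = 0 := by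
    refine Finset.sum_eq_zero fun k _ => ?_
    rw [eq_zero_of_mem_degGE (d := 1 + n) (by omega) (mul_mem_degGE (h1 k) omega_mem_degGE),
      map_zero]
  simp only [pd_mul_of_mem (hG _), Finset.sum_add_distrib, ← Finset.sum_mul, dG, zero_mul,
    zero_add, ← Finset.smul_sum] at h
  rw [fld_apply]
  exact (smul_eq_zero.1 h).resolve_left (by simp)

theorem pd_dijCoeff (m i j k : Fin n) (f : Grassmann K n) :
    pd K n m (dijCoeff i j f k) = -dijCoeff i j (pd K n m f) k := by
  simp only [dijCoeff, Pi.add_apply, Pi.single_apply, map_add, apply_ite, map_zero]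
  rw [pd_comm m i, pd_comm m j]
  split_ifs <;> simp [add_comm]

theorem pd_pd_mem_span_one {l : List (Fin n)} (hl : l.length = 2) (i j : Fin n) :
    pd K n i (pd K n j (lp K l)) ∈ Submodule.span K {(1 : Grassmann K n)} := by
  obtain ⟨a, b, rfl⟩ := List.length_eq_two.1 hl
  rw [lp_cons, ← xi_eq_lp, pd_xi_mul, map_sub, pd_xi]
  have h1 : (1 : Grassmann K n) ∈ Submodule.span K {(1 : Grassmann K n)} :=
    Submodule.mem_span_singleton_self _
  refine sub_mem ?_ ?_
  · split_ifs
    · rw [pd_xi]; split_ifs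
      · exact h1
      · exact zero_mem _
    · rw [map_zero]; exact zero_mem _
  · split_ifs
    · rw [mul_one, pd_xi]; split_ifs
      · exact h1
      · exact zero_mem _
    · rw [mul_zero, map_zero]; exact zero_mem _

/-- The field D_ij(x^l) kills 1 + ω, so only the derivatives of its coefficients contribute. For |l|
> 2 the factor ω drops out by degree and -D_ij(∂_m x^l) remains; for |l| = 2 these derivatives are
constants, leaving a combination of the (1 + ω)∂_k. -/
theorem superBracket_one_add_omega_mem (hn : Even n) (m i j : Fin n) {l : List (Fin n)}
    (hl : 2 ≤ l.length) :
    superBracket 1 (l.length : ZMod 2) (vf (1 + mono K n Finset.univ) m) (Dij i j (lp K l)) ∈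
      STilde K n := by
  have hdeg : ∀ k, dijCoeff i j (lp K l) k ∈ degGE K n 1 :=
    dijCoeff_mem_degGE (d := 1) (lp_mem_degGE hl) i j
  have h0 : fld (dijCoeff i j (lp K l)) (1 + mono K n Finset.univ) = 0 := by
    rw [map_add, fld_omega (dijCoeff_lp_mem i j l) hdeg (div_dijCoeff _ _ _), fld_apply]
    simp
  have e : superBracket 1 (l.length : ZMod 2) (vf (1 + mono K n Finset.univ) m)
      (Dij i j (lp K l)) =
      fld fun k => (1 + mono K n Finset.univ) * pd K n m (dijCoeff i j (lp K l) k) := by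
    rw [vf_eq_fld, Dij_eq_fld, superBracket_fld
      (fun k => map_single_mem (one_add_omega_mem' hn) k) (dijCoeff_lp_mem i j l)]
    congr 1
    funext k
    have : fld (dijCoeff i j (lp K l))
        ((Pi.single m (1 + mono K n Finset.univ) : Fin n → Grassmann K n) k) = 0 := by
      rw [Pi.single_apply]; split_ifs
      · exact h0
      · exact map_zero _
    rw [this, smul_zero, sub_zero, ← vf_eq_fld, vf_apply]
  rw [e]
  rcases hl.lt_or_eq with hl | hl
  · have hm : pd K n m (lp K l) ∈ degGE K n 2 := pd_mem_degGE (d := 2) (lp_mem_degGE hl) m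
    have : (fun k => (1 + mono K n Finset.univ) * pd K n m (dijCoeff i j (lp K l) k)) =
        -dijCoeff i j (pd K n m (lp K l)) := by
      funext k
      have h1 : dijCoeff i j (pd K n m (lp K l)) k ∈ degGE K n 1 :=
        dijCoeff_mem_degGE (d := 1) hm i j k
      rw [pd_dijCoeff, add_mul, one_mul, mul_neg, omega_mul h1, neg_zero, add_zero, Pi.neg_apply]
    rw [this, map_neg, ← Dij_eq_fld]
    exact neg_mem (Dij_mem_STilde i j hm)
  · rw [fld_eq]
    refine sum_mem fun k _ => ?_
    have : dijCoeff i j (lp K l) k ∈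
        (Submodule.span K {(1 : Grassmann K n)}).comap (pd K n m) :=
      dijCoeff_mem (N := (Submodule.span K {(1 : Grassmann K n)}).comap (pd K n m))
        (Submodule.mem_comap.2 (pd_pd_mem_span_one hl.symm m i))
        (Submodule.mem_comap.2 (pd_pd_mem_span_one hl.symm m j)) k
    obtain ⟨c, hc⟩ := Submodule.mem_span_singleton.1 (Submodule.mem_comap.1 this)
    rw [← hc, mul_smul_comm, mul_one, ← vfL_apply, map_smul]
    exact Submodule.smul_mem _ _ (vf_one_add_omega_mem k)

theorem isSubLieSuperalgebra_STilde (hn : Even n) (hn2 : 2 ≤ n) :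
    IsSubLieSuperalgebra (STilde K n) := by
  have h := STilde_eq_span (K := K) (n := n)
  have hw := one_add_omega_mem' (K := K) hn
  rw [h]
  refine isSubLieSuperalgebra_span (par := Sum.elim (fun _ => 1) (fun x => x.2.2.1.length))
    ?_ ?_
  · rintro (j | x)
    · exact vf_mem hw j
    · simp only [Sum.elim_inr, Dij_eq_fld]
      exact fld_mem (dijCoeff_lp_mem _ _ _)
  · rw [← h]
    rintro (i | ⟨i, j, l, hl⟩) (i' | ⟨i', j', l', hl'⟩) <;>
      simp only [Sum.elim_inr, Sum.elim_inl]
    · rw [superBracket_vf hw hw]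
      -- Since n ≥ 2, ∂_k ω has no constant term and ω ∂_k ω = 0. The bracket of (1 + ω)∂_i and (1 +
      -- ω)∂_{i'} is therefore D_ij(ω) with j = i'.
      have e : ∀ k, (1 + mono K n Finset.univ) * pd K n k (1 + mono K n Finset.univ) =
          pd K n k (mono K n Finset.univ) := by
        intro k
        have hk : pd K n k (mono K n Finset.univ) ∈ degGE K n 1 := by
          refine pd_mem_degGE ((?_ : degGE K n n ≤ _) omega_mem_degGE) k
          exact Submodule.span_mono fun f ⟨l, hl, e⟩ => ⟨l, by omega, e⟩
        rw [map_add, pd_one, zero_add, add_mul, one_mul, omega_mul hk, add_zero]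
      rw [e, e]
      have := Dij_mem_STilde (K := K) i i' (f := mono K n Finset.univ)
        (lp_mem_degGE (by simpa using hn2))
      have e2 := sub_sign_one (K := K) (vf (pd K n i (mono K n Finset.univ)) i')
        (vf (pd K n i' (mono K n Finset.univ)) i)
      exact e2 ▸ this
    · exact superBracket_one_add_omega_mem hn _ _ _ hl'
    · rw [superBracket_swap]
      exact neg_mem (Submodule.smul_mem _ _ (superBracket_one_add_omega_mem hn _ _ _ hl))
    · rw [Dij_eq_fld, Dij_eq_fld, superBracket_eq_sum_Dij (dijCoeff_lp_mem _ _ _)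
        (dijCoeff_lp_mem _ _ _) (div_dijCoeff _ _ _) (div_dijCoeff _ _ _)]
      refine Submodule.smul_mem _ _ (sum_mem fun a _ => sum_mem fun b _ => Dij_mem_STilde _ _ ?_)
      have hd : ∀ i j k, ∀ l : List (Fin n), 2 ≤ l.length →
          dijCoeff i j (lp K l) k ∈ degGE K n 1 := fun i j k l hl =>
        dijCoeff_mem_degGE (d := 1) (lp_mem_degGE hl) i j k
      exact mul_mem_degGE (d := 1) (e := 1) (hd _ _ _ _ hl) (hd _ _ _ _ hl')

end STildeClosure

/-! ### Generating the fields of W(n), S(n) and S̃(n) -/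

section Generation

variable {K : Type*} [Field K] {n : ℕ} {M : Submodule K (Gl K n)}

theorem vf_zero (i : Fin n) : vf (0 : Grassmann K n) i = 0 := map_zero (vfL i)

theorem vf_neg (f : Grassmann K n) (i : Fin n) : vf (-f) i = -vf f i := map_neg (vfL i) f

theorem vf_perm {l l' : List (Fin n)} (h : l.Perm l') {i : Fin n} (hl : vf (lp K l) i ∈ M) :
    vf (lp K l') i ∈ M := lp_perm_mem (vfL i) h hl

theorem Dij_self_lp {i : Fin n} {l : List (Fin n)} (h : i ∉ l) :
    Dij i i (lp K (i :: l)) = (2 : K) • vf (lp K l) i := by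
  rw [Dij, pd_lp_cons_self h, two_smul]

theorem Dij_lp {i j : Fin n} {l : List (Fin n)} (hi : i ∉ l) (hj : j ∉ l) (hij : i ≠ j) :
    Dij i j (lp K (i :: j :: l)) = vf (lp K (j :: l)) j - vf (lp K (i :: l)) i := by
  rw [Dij, pd_lp_cons_self (by simp [hij, hi]), lp_cons i, pd_xi_mul, if_neg hij,
    pd_lp_cons_self hj, zero_sub, vf_neg, ← sub_eq_add_neg, ← lp_cons]

/-- The difference is the bracket of ξ_j x^l ∂_i with ξ_i ∂_j. Both coefficients are nonconstant, so
the fields ∂_j, absent from S̃(n), are not needed. -/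
theorem vf_sub_mem (hM : IsSubLieSuperalgebra M)
    (h : ∀ l : List (Fin n), l ≠ [] → l.Nodup → ∀ i ∉ l, vf (lp K l) i ∈ M) {i j : Fin n}
    {l : List (Fin n)} (hl : l.Nodup) (hi : i ∉ l) (hj : j ∉ l) (hij : i ≠ j) :
    vf (lp K (j :: l)) j - vf (lp K (i :: l)) i ∈ M := by
  have h1 := h (j :: l) (by simp) (List.nodup_cons.2 ⟨hj, hl⟩) i (by simp [hij, hi])
  have h2 := h [i] (by simp) (by simp) j (by simpa using hij.symm)
  have := bracket_vf_mem hM (lp_mem (j :: l)) (lp_mem_of_odd (K := K) (l := [i]) (by simp)) h1 h2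
  rwa [pd_lp_cons_self (by simp), lp_nil, mul_one, pd_lp_cons_self hj, ← xi_eq_lp, ← lp_cons,
    show (1 + 1 : ZMod 2) = 0 from rfl, ZMod.val_zero, mul_zero, pow_zero, one_smul] at this

/-- According to which of i, j occur in l, the field is, up to a scalar, zero, some x^u∂_k with k ∉
u, or a difference as in `vf_sub_mem`. The bound |l| ≥ 2 keeps x^u nonconstant. -/
theorem Dij_mem_of_vf_mem (hM : IsSubLieSuperalgebra M)
    (h : ∀ l : List (Fin n), l ≠ [] → l.Nodup → ∀ i ∉ l, vf (lp K l) i ∈ M) (i j : Fin n)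
    {l : List (Fin n)} (hl : l.Nodup) (h2 : 2 ≤ l.length) : Dij i j (lp K l) ∈ M := by
  by_cases hi : i ∈ l
  · have hp := List.perm_cons_erase hi
    have hn := hp.nodup_iff.1 hl
    have hlen := hp.length_eq
    refine lp_perm_mem (DijL i j) hp.symm ?_
    rw [DijL_apply]
    generalize l.erase i = l' at *
    obtain ⟨hi', hn'⟩ := List.nodup_cons.1 hn
    have hne : l' ≠ [] := by rintro rfl; simp at hlen; omega
    by_cases hij : i = j
    · subst hij
      rw [Dij_self_lp hi']
      exact Submodule.smul_mem _ _ (h l' hne hn' i hi')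
    · by_cases hj : j ∈ l'
      · have hp' := List.perm_cons_erase hj
        have hn2 := hp'.nodup_iff.1 hn'
        refine lp_perm_mem (DijL i j) (hp'.symm.cons i) ?_
        rw [DijL_apply]
        have hi2 : i ∉ l'.erase j := fun hm => hi' (List.mem_of_mem_erase hm)
        obtain ⟨hj2, hn3⟩ := List.nodup_cons.1 hn2
        rw [Dij_lp hi2 hj2 hij]
        exact vf_sub_mem hM h hn3 hi2 hj2 hij
      · rw [Dij, pd_lp_cons_self hi', pd_lp_of_notMem (by simp [Ne.symm hij, hj]), vf_zero,
          add_zero]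
        exact h l' hne hn' j hj
  · by_cases hj : j ∈ l
    · have hp := List.perm_cons_erase hj
      have hn := hp.nodup_iff.1 hl
      have hlen := hp.length_eq
      have hij : i ≠ j := fun e => hi (e ▸ hj)
      refine lp_perm_mem (DijL i j) hp.symm ?_
      rw [DijL_apply]
      have hi' : i ∉ l.erase j := fun hm => hi (List.mem_of_mem_erase hm)
      generalize l.erase j = l' at *
      obtain ⟨hj', hn'⟩ := List.nodup_cons.1 hn
      rw [Dij, pd_lp_cons_self hj', pd_lp_of_notMem (by simp [hij, hi']), vf_zero, zero_add]
      exact h l' (by rintro rfl; simp at hlen; omega) hn' i hi'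
    · rw [Dij, pd_lp_of_notMem hi, pd_lp_of_notMem hj, vf_zero, vf_zero, add_zero]
      exact zero_mem _

/-- The bracket of ξ_kξ_m∂_i with ξ_i∂_m is this divergence-free quadratic field, the raising
operator of `vf_cons_mem`. -/
theorem vf_add_mem (hM : IsSubLieSuperalgebra M) {i k m : Fin n} (hkm : k ≠ m)
    (hA : vf (lp K [k, m]) i ∈ M) (hC : vf (lp K [i]) m ∈ M) :
    vf (lp K [k, m]) m + vf (lp K [i, k]) i ∈ M := by
  have h := bracket_vf_mem hM (lp_mem_of_even (K := K) (l := [k, m]) (by simp))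
    (lp_mem_of_odd (K := K) (l := [i]) (by simp)) hA hC
  have e1 : pd K n m (lp K [k, m]) = -xi K n k := by
    rw [lp_cons, ← xi_eq_lp, pd_xi_mul, if_neg hkm, pd_xi, if_pos rfl]; simp
  rwa [pd_lp_cons_self (by simp), lp_nil, mul_one, e1, ← xi_eq_lp, mul_neg, vf_neg,
    show (1 + 1 : ZMod 2) = 0 from rfl, ZMod.val_zero, mul_zero, pow_zero, one_smul,
    sub_neg_eq_add, xi_eq_lp k, ← lp_cons] at h

theorem superBracket_vf_of_even {l l' : List (Fin n)} (hl : Even l.length) (hl' : Even l'.length)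
    (i j : Fin n) : superBracket 1 1 (vf (lp K l) i) (vf (lp K l') j) =
      vf (lp K l * pd K n i (lp K l')) j + vf (lp K l' * pd K n j (lp K l)) i :=
  (superBracket_vf (p := 1) (q := 1) (lp_mem_of_even hl) (lp_mem_of_even hl') i j).trans
    (sub_sign_one _ _)

theorem vf_odd_of_even {l : List (Fin n)} (hl : Even l.length) (i : Fin n) :
    vf (lp K l) i ∈ glParity K n 1 := vf_mem (p := 1) (lp_mem_of_even hl) i

/-- Each summand of the raising field takes ξ_m x^r ∂_i to ξ_kξ_m x^r ∂_i, so their sum gives twice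
the wanted field. The summands are not divergence-free and need not lie in M separately. -/
theorem vf_cons_mem (hM : IsSubLieSuperalgebra M) [CharZero K] {i k m : Fin n}
    {r : List (Fin n)} (hik : i ≠ k) (him : i ≠ m) (hir : i ∉ r) (hmr : m ∉ r)
    (hv : Even (m :: r).length) (hEm : vf (lp K [k, m]) m + vf (lp K [i, k]) i ∈ M)
    (hV : vf (lp K (m :: r)) i ∈ M) : vf (lp K (k :: m :: r)) i ∈ M := by
  have q1 : Even [k, m].length := ⟨1, rfl⟩
  have q2 : Even [i, k].length := ⟨1, rfl⟩
  have b1 : superBracket 1 1 (vf (lp K [k, m]) m) (vf (lp K (m :: r)) i) =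
      vf (lp K (k :: m :: r)) i := by
    rw [superBracket_vf_of_even q1 hv, pd_lp_cons_self hmr, pd_lp_of_notMem (by simp [hik, him]),
      mul_zero, vf_zero, add_zero, ← lp_append]
    rfl
  have b2 : superBracket 1 1 (vf (lp K [i, k]) i) (vf (lp K (m :: r)) i) =
      vf (lp K (k :: m :: r)) i := by
    have hc := super_comm (lp_mem_of_even (K := K) hv)
      (lp_mem_of_odd (K := K) (l := [k]) (by simp))
    rw [ZMod.val_zero, zero_mul, pow_zero, one_smul] at hc
    rw [superBracket_vf_of_even q2 hv, pd_lp_of_notMem (by simp [him, hir]),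
      pd_lp_cons_self (by simpa using hik), mul_zero, vf_zero, hc, zero_add,
      ← lp_append]
    rfl
  have hB := hM.bracket_mem 1 1 _ ⟨hEm, add_mem (vf_odd_of_even q1 m) (vf_odd_of_even q2 i)⟩ _
    ⟨hV, vf_odd_of_even hv i⟩
  rw [superBracket_eq, map_add, LinearMap.add_apply, ← superBracket_eq, ← superBracket_eq, b1,
    b2, ← two_smul K] at hB
  exact (Submodule.smul_mem_iff M two_ne_zero).1 hB

/-- Beyond the hypotheses only odd |l| = n - 1 is left, where no index outside l and i is available
for lowering from a higher degree; raising is used instead. Excluding l = [] makes the argument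
serve S̃(n) as well. -/
theorem vf_mem_of_even (hM : IsSubLieSuperalgebra M) [CharZero K] (hn : 4 ≤ n)
    (hE : ∀ l : List (Fin n), l ≠ [] → l.Nodup → Even l.length → ∀ i ∉ l, vf (lp K l) i ∈ M)
    (hO : ∀ l : List (Fin n), l.Nodup → Odd l.length → l.length + 2 ≤ n → ∀ i ∉ l,
      vf (lp K l) i ∈ M)
    (l : List (Fin n)) (hl : l ≠ []) (hnd : l.Nodup) (i : Fin n) (hi : i ∉ l) :
    vf (lp K l) i ∈ M := by
  rcases Nat.even_or_odd l.length with he | ho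
  · exact hE l hl hnd he i hi
  by_cases hlen : l.length + 2 ≤ n
  · exact hO l hnd ho hlen i hi
  obtain ⟨k, m, r, rfl⟩ : ∃ k m r, l = k :: m :: r := by
    rcases l with _ | ⟨k, _ | ⟨m, r⟩⟩
    · simp at hl
    · simp at hlen; omega
    · exact ⟨k, m, r, rfl⟩
  simp only [List.nodup_cons, List.mem_cons, not_or] at hnd hi
  obtain ⟨⟨hkm, hkr⟩, hmr, hr⟩ := hnd
  obtain ⟨hik, him, hir⟩ := hi
  have hv : Even (m :: r).length := by
    rw [List.length_cons, Nat.odd_add_one, Nat.not_odd_iff_even] at ho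
    exact ho
  have hA := hE [k, m] (by simp) (by simp [hkm]) (by simp) i (by simp [hik, him])
  have hC := hO [i] (by simp) (by simp) (by simp; omega) m (by simpa using Ne.symm him)
  exact vf_cons_mem hM hik him hir hmr hv (vf_add_mem hM hkm hA hC)
    (hE (m :: r) (by simp) (by simp [hmr, hr]) hv i (by simp [him, hir]))

theorem exists_notMem_cons {l : List (Fin n)} {i : Fin n} (h : l.length + 2 ≤ n) :
    ∃ j, j ∉ l ∧ j ≠ i := by
  by_contra! hc
  have : (Finset.univ : Finset (Fin n)) ⊆ (i :: l).toFinset := by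
    intro j _
    by_cases hj : j ∈ l
    · simp [hj]
    · simp [hc j hj]
  have := (Finset.card_le_card this).trans (List.toFinset_card_le _)
  simp at this
  omega

/-- With a spare index j, the field is the bracket of ∂_j with ξ_j x^l ∂_i, whose coefficient has
even degree. -/
theorem vf_mem_of_bracket_pd (hM : IsSubLieSuperalgebra M)
    (hE : ∀ l : List (Fin n), l.Nodup → Even l.length → ∀ i ∉ l, vf (lp K l) i ∈ M)
    (l : List (Fin n)) (hnd : l.Nodup) (ho : Odd l.length) (hlen : l.length + 2 ≤ n) (i : Fin n)
    (hi : i ∉ l) : vf (lp K l) i ∈ M := by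
  obtain ⟨j, hj, hji⟩ := exists_notMem_cons (i := i) hlen
  have h1 := hE [] (by simp) (by simp) j (by simp)
  have h2 := hE (j :: l) (by simp [hj, hnd]) (by simpa using ho.add_one) i
    (by simp [Ne.symm hji, hi])
  have := bracket_vf_mem_left hM one_mem_parity (lp_mem (j :: l)) h1 h2 (by simp)
  rwa [pd_lp_cons_self hj, one_mul] at this

/-- Here (1 + ω)∂_j acts like ∂_j: the extra terms involve ω x^l and ξ_j x^l ∂_i ω, both zero by
degree. -/
theorem vf_mem_of_bracket_one_add_omega (hM : IsSubLieSuperalgebra M) (hn : Even n)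
    (h1 : ∀ j, vf (1 + mono K n Finset.univ) j ∈ M)
    (hE : ∀ l : List (Fin n), l ≠ [] → l.Nodup → Even l.length → ∀ i ∉ l, vf (lp K l) i ∈ M)
    (l : List (Fin n)) (hnd : l.Nodup) (ho : Odd l.length) (hlen : l.length + 2 ≤ n) (i : Fin n)
    (hi : i ∉ l) : vf (lp K l) i ∈ M := by
  obtain ⟨j, hj, hji⟩ := exists_notMem_cons (i := i) hlen
  have h2 := hE (j :: l) (by simp) (by simp [hj, hnd]) (by simpa using ho.add_one) i
    (by simp [Ne.symm hji, hi])
  have hpos := ho.pos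
  have := bracket_vf_mem_left hM (one_add_omega_mem hn) (lp_mem (j :: l)) (h1 j) h2 ?_
  · rwa [pd_lp_cons_self hj, add_mul, one_mul, omega_mul (lp_mem_degGE hpos), add_zero] at this
  · rw [map_add, pd_one, zero_add]
    exact eq_zero_of_mem_degGE (by simp; omega)
      (mul_mem_degGE (lp_mem_degGE (le_refl (j :: l).length)) (pd_omega_mem (by omega) i))

/-- Brackets with ξ_{j'}∂_j, and the differences of `vf_sub_mem`, spread the single given field to
all ξ_jξ_i∂_i. Derivatives lower these to ξ_i∂_i, and brackets with ξ_kξ_m∂_m lengthen the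
coefficient one factor at a time. -/
theorem vf_mem_of_divergence (hM : IsSubLieSuperalgebra M) (hn : 3 ≤ n)
    (h : ∀ l : List (Fin n), l.Nodup → ∀ i ∉ l, vf (lp K l) i ∈ M) {i₀ i₁ : Fin n}
    (h01 : i₀ ≠ i₁) (hc : vf (lp K [i₀, i₁]) i₁ ∈ M) (l : List (Fin n)) (i : Fin n) :
    vf (lp K l) i ∈ M := by
  have change_left : ∀ j j' i, j ≠ i → j' ≠ i → vf (lp K [j, i]) i ∈ M →
      vf (lp K [j', i]) i ∈ M := by
    intro j j' i hj hj' hm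
    by_cases hjj : j' = j
    · rwa [hjj]
    have h1 := h [j'] (by simp) j (by simpa using Ne.symm hjj)
    have := bracket_vf_mem_left hM (lp_mem [j']) (lp_mem [j, i]) h1 hm
      (by rw [pd_lp_of_notMem (by simpa using Ne.symm hj'), mul_zero])
    rwa [pd_lp_cons_self (by simpa using hj), ← lp_append] at this
  have change_right : ∀ j i i', j ≠ i → j ≠ i' → vf (lp K [j, i]) i ∈ M →
      vf (lp K [j, i']) i' ∈ M := by
    intro j i i' hi hi' hm
    by_cases hii : i = i'
    · rwa [← hii]
    have := vf_sub_mem hM (fun l _ => h l) (l := [j]) (by simp) (i := i) (j := i')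
      (by simpa using Ne.symm hi) (by simpa using Ne.symm hi') hii
    have h2 := add_mem this (vf_perm (List.Perm.swap _ _ _) hm)
    rw [sub_add_cancel] at h2
    exact vf_perm (List.Perm.swap _ _ _) h2
  have hT : ∀ j i, j ≠ i → vf (lp K [j, i]) i ∈ M := by
    intro j i hji
    -- The passage from (i₀, i₁) to (j, i) goes through a third index k, so that no intermediate
    -- field has a repeated index.
    obtain ⟨k, hk, hki⟩ := exists_notMem_cons (l := [i₁]) (i := i) (by simpa using hn)
    rw [List.mem_singleton] at hk
    exact change_left k j i hki hji
      (change_right k i₁ i hk hki (change_left i₀ k i₁ h01 hk hc))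
  by_cases hnd : l.Nodup
  swap
  · rw [lp_of_not_nodup hnd, vf_zero]; exact zero_mem _
  by_cases hi : i ∈ l
  swap
  · exact h l hnd i hi
  have hp := List.perm_cons_erase hi
  refine vf_perm hp.symm ?_
  replace hnd := hp.nodup_iff.1 hnd
  clear hp hi
  generalize l.erase i = r at *
  induction r with
  | nil =>
    obtain ⟨k, -, hki⟩ := exists_notMem_cons (l := []) (i := i) (by simp; omega)
    have := bracket_vf_mem_left hM one_mem_parity (lp_mem [k, i]) (h [] (by simp) k (by simp))
      (hT k i hki) (by simp)
    rwa [pd_lp_cons_self (by simpa using hki), one_mul] at this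
  | cons k r ih =>
    simp only [List.nodup_cons, List.mem_cons, not_or] at hnd
    obtain ⟨⟨hik, hir⟩, hkr, hr⟩ := hnd
    rcases r with _ | ⟨m, r⟩
    · exact vf_perm (List.Perm.swap _ _ _) (hT k i (Ne.symm hik))
    · have ih' := vf_perm (List.Perm.swap _ _ _) (ih (List.nodup_cons.2 ⟨hir, hr⟩))
      simp only [List.nodup_cons, List.mem_cons, not_or] at hir hkr hr
      have := bracket_vf_mem_left hM (lp_mem [k, m]) (lp_mem (m :: i :: r)) (hT k m hkr.1) ih'
        (by rw [pd_lp_of_notMem (by simp [hik, hir.1]), mul_zero])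
      rw [pd_lp_cons_self (by simp [Ne.symm hir.1, hr.1]), ← lp_append] at this
      refine vf_perm ?_ this
      exact ((List.Perm.swap i m r).cons k).trans (List.Perm.swap i k _)

end Generation

/-! ### Distinct weights, and the theorem for W(n), S(n) and S̃(n) -/

section Weights

variable {K : Type*} [Field K] {n : ℕ}

/-- The integral weight of `x^u ∂/∂ξ_i`. -/
def wt (x : Finset (Fin n) × Fin n) (k : Fin n) : ℤ :=
  (if k ∈ x.1 then 1 else 0) - if k = x.2 then 1 else 0

theorem sum_sub_eq_sum_wt (a : Fin n → K) (x : Finset (Fin n) × Fin n) :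
    ∑ k ∈ x.1, a k - a x.2 = ∑ k, (wt x k : K) * a k := by
  simp [wt, sub_mul, Finset.sum_sub_distrib]

/-- Genericity still allows relations with all coefficients equal, so equal eigenvalues determine
the integral weights only up to a constant vector. -/
theorem wt_sub_const {a : Fin n → K}
    (ha : ∀ d : Fin n → ℤ, (∀ k, |d k| ≤ 2) → ∑ k, (d k : K) * a k = 0 → ∀ i j, d i = d j)
    {x y : Finset (Fin n) × Fin n} (h : ∑ k ∈ x.1, a k - a x.2 = ∑ k ∈ y.1, a k - a y.2)
    (i j : Fin n) : wt x i - wt y i = wt x j - wt y j := by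
  refine ha (fun k => wt x k - wt y k) (fun k => ?_) ?_ i j
  · simp only [wt]; split_ifs <;> simp
  · rw [sum_sub_eq_sum_wt, sum_sub_eq_sum_wt] at h
    simp [sub_mul, Finset.sum_sub_distrib, h]

/-- The weight is -1 exactly at the index of ∂. If these indices differ, the difference of weights
is negative at one and positive at the other; if they agree, it vanishes there and so everywhere. -/
theorem eq_of_wt_sub_const {x y : Finset (Fin n) × Fin n} (hx : x.2 ∉ x.1) (hy : y.2 ∉ y.1)
    (h : ∀ i j, wt x i - wt y i = wt x j - wt y j) : x = y := by
  obtain ⟨u, i⟩ := x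
  obtain ⟨v, j⟩ := y
  simp only at hx hy
  have hij : i = j := by
    by_contra hij
    have := h i j
    have hji : j ≠ i := Ne.symm hij
    simp only [wt, hx, hy, hij, hji, if_true, if_false] at this
    split_ifs at this <;> omega
  subst hij
  have hc : ∀ k, wt (u, i) k - wt (v, i) k = 0 := fun k => by
    rw [h k i]; simp [wt, hx, hy]
  ext1
  · ext k
    have := hc k
    simp only [wt] at this
    by_cases h1 : k ∈ u <;> by_cases h2 : k ∈ v <;> simp [h1, h2] at this ⊢; omega
  · rfl

/-- The weight of the extra field is 1 at i₀ and 0 elsewhere. The difference is thus negative at x.2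
but nonnegative at any third index k. -/
theorem wt_sub_not_const (hn : 3 ≤ n) {x : Finset (Fin n) × Fin n} (hx : x.2 ∉ x.1)
    {i₀ i₁ : Fin n}
    (h : ∀ i j, wt x i - wt ({i₀, i₁}, i₁) i = wt x j - wt ({i₀, i₁}, i₁) j) : False := by
  obtain ⟨u, i⟩ := x
  obtain ⟨k, hk, hki⟩ := exists_notMem_cons (l := [i₀]) (i := i) (by simpa using hn)
  rw [List.mem_singleton] at hk
  simp only at hx
  have := h i k
  simp only [wt, hx, hk, hki, Finset.mem_insert, Finset.mem_singleton, if_true, if_false,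
    false_or] at this
  split_ifs at this <;> simp_all

theorem mono_mem_of_even {u : Finset (Fin n)} (hu : Even u.card) : mono K n u ∈ parity K n 0 :=
  lp_mem_of_even (by simpa using hu)

theorem vf_lp_mem_of_mono {M : Submodule K (Gl K n)}
    (h : ∀ u : Finset (Fin n), ∀ i, Even u.card → i ∉ u → vf (mono K n u) i ∈ M)
    {l : List (Fin n)} (hnd : l.Nodup) (he : Even l.length) {i : Fin n} (hi : i ∉ l) :
    vf (lp K l) i ∈ M := by
  refine map_lp_mem_of_mono (vfL i) fun _ => h _ i ?_ (by simpa using hi)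
  rwa [List.toFinset_card_of_nodup hnd]

/-- With trace zero, the field is a combination of the differences ξ_k∂_k - ξ_0∂_0, where 0 is the
first index, and these are the D_0k(ξ_0ξ_k). -/
theorem eul_mem_of_Dij_mem {L : Submodule K (Gl K n)} (hn : 0 < n)
    (h : ∀ i j : Fin n, Dij i j (lp K [i, j]) ∈ L) {a : Fin n → K} (ha : ∑ k, a k = 0) :
    eul a ∈ L := by
  have e : eul a = ∑ k, a k • (vf (xi K n k) k - vf (xi K n ⟨0, hn⟩) ⟨0, hn⟩) := by
    simp only [smul_sub, Finset.sum_sub_distrib, ← Finset.sum_smul, ha, zero_smul, sub_zero]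
    rw [eul, fld_eq]
    refine Finset.sum_congr rfl fun k _ => ?_
    rw [← vfL_apply, map_smul, vfL_apply]
  rw [e]
  refine sum_mem fun k _ => Submodule.smul_mem _ _ ?_
  by_cases hk : ⟨0, hn⟩ = k
  · rw [← hk, sub_self]; exact zero_mem _
  · have := h ⟨0, hn⟩ k
    rwa [Dij_lp (by simp) (by simp) hk, ← xi_eq_lp, ← xi_eq_lp] at this

theorem vf_mem_of_Dij_mem [CharZero K] {L : Submodule K (Gl K n)} {l : List (Fin n)} {i : Fin n}
    (hi : i ∉ l) (h : Dij i i (lp K (i :: l)) ∈ L) : vf (lp K l) i ∈ L := by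
  rw [Dij_self_lp hi] at h
  exact (Submodule.smul_mem_iff L two_ne_zero).1 h

theorem SComp_le_of_Dij_mem {M : Submodule K (Gl K n)} {d : ℕ}
    (h : ∀ i j, ∀ l : List (Fin n), l.Nodup → l.length = d → Dij i j (lp K l) ∈ M) :
    SComp K n d ≤ M := by
  rw [SComp, Submodule.span_le]
  rintro _ ⟨i, j, u, hu, rfl⟩
  exact h i j _ (Finset.sort_nodup _ _) (by simpa using hu)

theorem S_le_of_vf_mem {M : Submodule K (Gl K n)} (hM : IsSubLieSuperalgebra M)
    (h : ∀ l : List (Fin n), l.Nodup → ∀ i ∉ l, vf (lp K l) i ∈ M) : S K n ≤ M := by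
  refine iSup₂_le fun d hd => SComp_le_of_Dij_mem fun i j l hl hd' => ?_
  by_cases h2 : 2 ≤ l.length
  · exact Dij_mem_of_vf_mem hM (fun l _ => h l) i j hl h2
  · have h1 : l.length = 1 := by have := (Finset.mem_Icc.1 hd).1; omega
    obtain ⟨a, rfl⟩ := List.length_eq_one_iff.1 h1
    have h0 : ∀ j, vf (1 : Grassmann K n) j ∈ M := fun j => h [] (by simp) j (by simp)
    rw [← xi_eq_lp, Dij, pd_xi, pd_xi]
    refine add_mem ?_ ?_ <;> split_ifs
    · exact h0 j
    · rw [vf_zero]; exact zero_mem _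
    · exact h0 i
    · rw [vf_zero]; exact zero_mem _

theorem vf_mem_of_mono_even [CharZero K] (hn : 3 ≤ n) {M : Submodule K (Gl K n)}
    (hM : IsSubLieSuperalgebra M)
    (h : ∀ u : Finset (Fin n), ∀ i, Even u.card → i ∉ u → vf (mono K n u) i ∈ M)
    (l : List (Fin n)) (hl : l.Nodup) (i : Fin n) (hi : i ∉ l) : vf (lp K l) i ∈ M := by
  have hE : ∀ l : List (Fin n), l.Nodup → Even l.length → ∀ i ∉ l, vf (lp K l) i ∈ M :=
    fun l hl he i hi => vf_lp_mem_of_mono h hl he hi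
  have hO := vf_mem_of_bracket_pd hM hE
  -- For n = 3 an odd monomial avoiding i has degree 1, so lowering suffices and no raising is
  -- required.
  rcases hn.eq_or_lt with rfl | hn
  · rcases Nat.even_or_odd l.length with he | ho
    · exact hE l hl he i hi
    · refine hO l hl ho ?_ i hi
      have := (List.nodup_cons.2 ⟨hi, hl⟩).length_le_card
      rw [List.length_cons, Fintype.card_fin] at this
      obtain ⟨r, hr⟩ := ho
      omega
  · by_cases h0 : l = []
    · subst h0; exact hE [] hl (by simp) i hi
    · exact vf_mem_of_even hM hn (fun l _ => hE l) hO l h0 hl i hi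

/-- The indices of the fields `x^u ∂/∂ξ_i` with `|u|` even and `i ∉ u`. -/
def evenPairs (n : ℕ) : Finset (Finset (Fin n) × Fin n) :=
  Finset.univ.filter fun x => Even x.1.card ∧ x.2 ∉ x.1

theorem mem_evenPairs {x : Finset (Fin n) × Fin n} :
    x ∈ evenPairs n ↔ Even x.1.card ∧ x.2 ∉ x.1 := by simp [evenPairs]

theorem isGeneratedByOne_S [CharZero K] (hn : 3 ≤ n) : IsGeneratedByOne (S K n) := by
  obtain ⟨a, ha0, ha⟩ := exists_traceless K n
  refine isGeneratedByOne_of_eigenvectors isSubLieSuperalgebra_S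
    (eul_mem_of_Dij_mem (by omega) (fun i j => Dij_mem_S i j _) ha0) (eul_mem a) (evenPairs n)
    (fun x => vf (mono K n x.1) x.2) (fun x => ∑ k ∈ x.1, a k - a x.2) ?_ ?_ ?_ ?_ ?_
  · intro x hx
    exact vf_mem_of_Dij_mem (by simpa using (mem_evenPairs.1 hx).2) (Dij_mem_S _ _ _)
  · intro x hx
    exact vf_mem (p := 1) (mono_mem_of_even (mem_evenPairs.1 hx).1) _
  · intro x hx
    exact eul_bracket_vf a (q := 1) (mono_mem_of_even (mem_evenPairs.1 hx).1) _ (eul_mono a _)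
  · intro x hx y hy h
    exact eq_of_wt_sub_const (mem_evenPairs.1 hx).2 (mem_evenPairs.1 hy).2 (wt_sub_const ha h)
  · intro M hM _ hv
    exact S_le_of_vf_mem hM (vf_mem_of_mono_even hn hM
      fun u i hu hi => hv (u, i) (mem_evenPairs.2 ⟨hu, hi⟩))

theorem isGeneratedByOne_W [CharZero K] (hn : 3 ≤ n) : IsGeneratedByOne (W K n) := by
  obtain ⟨a, -, ha⟩ := exists_traceless K n
  let i₀ : Fin n := ⟨0, by omega⟩
  let i₁ : Fin n := ⟨1, by omega⟩
  have h01 : i₀ ≠ i₁ := by simp [i₀, i₁]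
  have hcard : ∀ x ∈ insert (({i₀, i₁} : Finset (Fin n)), i₁) (evenPairs n), Even x.1.card := by
    intro x hx
    rcases Finset.mem_insert.1 hx with rfl | hx
    · rw [Finset.card_pair h01]; exact even_two
    · exact (mem_evenPairs.1 hx).1
  refine isGeneratedByOne_of_eigenvectors isSubLieSuperalgebra_W (fld_mem_W _) (eul_mem a)
    (insert ({i₀, i₁}, i₁) (evenPairs n))
    (fun x => vf (mono K n x.1) x.2) (fun x => ∑ k ∈ x.1, a k - a x.2) ?_ ?_ ?_ ?_ ?_
  · intro x _
    exact vf_mem_W _ _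
  · intro x hx
    exact vf_mem (p := 1) (mono_mem_of_even (hcard x hx)) _
  · intro x hx
    exact eul_bracket_vf a (q := 1) (mono_mem_of_even (hcard x hx)) _ (eul_mono a _)
  · intro x hx y hy h
    rcases Finset.mem_insert.1 hx with rfl | hx <;> rcases Finset.mem_insert.1 hy with rfl | hy
    · rfl
    · exact (wt_sub_not_const hn (mem_evenPairs.1 hy).2 (wt_sub_const ha h.symm)).elim
    · exact (wt_sub_not_const hn (mem_evenPairs.1 hx).2 (wt_sub_const ha h)).elim
    · exact eq_of_wt_sub_const (mem_evenPairs.1 hx).2 (mem_evenPairs.1 hy).2 (wt_sub_const ha h)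
  · intro M hM _ hv
    have h1 := vf_mem_of_mono_even hn hM
      fun u i hu hi => hv (u, i) (Finset.mem_insert_of_mem (mem_evenPairs.2 ⟨hu, hi⟩))
    have h2 : vf (lp K [i₀, i₁]) i₁ ∈ M := by
      refine map_lp_mem_of_mono (vfL i₁) fun _ => ?_
      exact hv ({i₀, i₁}, i₁) (Finset.mem_insert_self _ _)
    rw [W_eq_span, Submodule.span_le]
    rintro _ ⟨⟨l, i⟩, rfl⟩
    exact vf_mem_of_divergence hM hn h1 h01 h2 l i

theorem isGeneratedByOne_STilde [CharZero K] (he : Even n) (hn : 4 ≤ n) :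
    IsGeneratedByOne (STilde K n) := by
  obtain ⟨a, ha0, ha⟩ := exists_traceless K n
  have hf : ∀ x ∈ evenPairs n, (if x.1 = ∅ then 1 + mono K n Finset.univ else mono K n x.1) ∈
      parity K n 0 := by
    intro x hx
    split_ifs
    · exact one_add_omega_mem he
    · exact mono_mem_of_even (mem_evenPairs.1 hx).1
  refine isGeneratedByOne_of_eigenvectors (isSubLieSuperalgebra_STilde he (by omega))
    (eul_mem_of_Dij_mem (by omega) (fun i j => Dij_mem_STilde i j (lp_mem_degGE (by simp))) ha0)
    (eul_mem a) (evenPairs n)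
    (fun x => vf (if x.1 = ∅ then 1 + mono K n Finset.univ else mono K n x.1) x.2)
    (fun x => ∑ k ∈ x.1, a k - a x.2) ?_ ?_ ?_ ?_ ?_
  · intro x hx
    by_cases h0 : x.1 = ∅
    · simp only [h0, if_true]
      exact vf_one_add_omega_mem _
    · simp only [h0, if_false]
      refine vf_mem_of_Dij_mem (by simpa using (mem_evenPairs.1 hx).2)
        (Dij_mem_STilde _ _ (lp_mem_degGE ?_))
      have := Finset.card_pos.2 (Finset.nonempty_iff_ne_empty.2 h0)
      rw [List.length_cons, Finset.length_sort]; omega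
  · intro x hx
    exact vf_mem (p := 1) (hf x hx) _
  · intro x hx
    refine eul_bracket_vf a (q := 1) (hf x hx) _ ?_
    -- The eigenvalue of ω is ∑ a_k = 0, equal to that of 1.
    split_ifs with h0
    · rw [map_add, eul_mono, ha0, h0]
      simp [eul, fld_apply]
    · exact eul_mono a _
  · intro x hx y hy h
    exact eq_of_wt_sub_const (mem_evenPairs.1 hx).2 (mem_evenPairs.1 hy).2 (wt_sub_const ha h)
  · intro M hM _ hv
    have h1 : ∀ j, vf (1 + mono K n Finset.univ) j ∈ M := fun j => by
      have := hv (∅, j) (mem_evenPairs.2 (by simp))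
      simpa using this
    have hE : ∀ l : List (Fin n), l ≠ [] → l.Nodup → Even l.length → ∀ i ∉ l,
        vf (lp K l) i ∈ M := by
      intro l hl hnd hev i hi
      refine map_lp_mem_of_mono (vfL i) fun _ => ?_
      have := hv (l.toFinset, i) (mem_evenPairs.2
        ⟨by rwa [List.toFinset_card_of_nodup hnd], by simpa using hi⟩)
      rw [vfL_apply]
      simpa [hl] using this
    have hall := vf_mem_of_even hM hn hE (vf_mem_of_bracket_one_add_omega hM he h1 hE)
    refine sup_le ?_ (iSup₂_le fun d hd => SComp_le_of_Dij_mem fun i j l hl hd' => ?_)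
    · rw [Submodule.span_le]
      rintro _ ⟨j, rfl⟩
      exact h1 j
    · exact Dij_mem_of_vf_mem hM hall i j hl (hd' ▸ (Finset.mem_Icc.1 hd).1)

end Weights

/-! ### The Poisson bracket and closure of H(n) -/

section Poisson

variable {K : Type*} [Field K] {n : ℕ}

theorem prime_prime (i : Fin n) : prime (prime i) = i := by
  have := i.isLt
  ext
  simp only [prime]
  split_ifs <;> omega

theorem prime_ne_of_ne {i j : Fin n} (h : i ≠ j) : prime i ≠ prime j :=
  fun e => h (by rw [← prime_prime i, e, prime_prime])

theorem prime_eq_comm {i j : Fin n} : prime i = j ↔ i = prime j :=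
  ⟨fun e => by rw [← e, prime_prime], fun e => by rw [e, prime_prime]⟩

theorem eq_of_prime_eq_self {i j : Fin n} (hi : prime i = i) (hj : prime j = j) : i = j := by
  have h1 := i.isLt
  have h2 := j.isLt
  rw [Fin.ext_iff] at hi hj ⊢
  simp only [prime] at hi hj
  split_ifs at hi hj <;> omega

theorem sum_prime {V : Type*} [AddCommMonoid V] (φ : Fin n → V) :
    ∑ i, φ (prime i) = ∑ i, φ i :=
  Fintype.sum_equiv (Function.Involutive.toPerm prime prime_prime) _ _ fun _ => rfl

/-- The hamiltonian field `∑ ∂f/∂ξ_i ∂/∂ξ_{i'}` without the sign of `DH`. -/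
def ham : Grassmann K n →ₗ[K] Gl K n := ∑ k : Fin n, vfL k ∘ₗ pd K n (prime k)

theorem ham_eq_fld (f : Grassmann K n) : ham f = fld fun k => pd K n (prime k) f := by
  simp [ham, fld_eq, vfL_apply]

theorem DH_eq_ham (f : Grassmann K n) : DH f = ham (CliffordAlgebra.involute f) := by
  rw [ham_eq_fld, fld_eq, ← sum_prime, DH]
  simp only [prime_prime]

theorem DH_mem_iff {M : Submodule K (Gl K n)} (l : List (Fin n)) :
    DH (lp K l) ∈ M ↔ ham (lp K l) ∈ M := by
  rw [DH_eq_ham, involute_of_mem (lp_mem l), map_smul]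
  exact Submodule.smul_mem_iff M (by simp)

theorem ham_mem {p : ZMod 2} {f : Grassmann K n} (hf : f ∈ parity K n p) :
    ham f ∈ glParity K n p := by
  rw [ham_eq_fld]
  exact fld_mem fun k => pd_mem hf _

/-- The Poisson bracket `∑ ∂f/∂ξ_i ∂g/∂ξ_{i'}` up to sign. -/
def poisson (f g : Grassmann K n) : Grassmann K n := ∑ i, pd K n i f * pd K n (prime i) g

theorem sign_poisson {V : Type*} [AddCommGroup V] [Module K V] (p q : ZMod 2) (x y : V) :
    x - (-1 : K) ^ (p.val * q.val) • y = (-1 : K) ^ p.val •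
      (-((-1 : K) ^ (p.val * (q + 1).val) • y) - (-1 : K) ^ (p + 1).val • x) := by
  rcases zmod_two p with rfl | rfl <;> rcases zmod_two q with rfl | rfl <;>
    simp [ZMod.val_one, show (1 + 1 : ZMod 2) = 0 from rfl, sub_eq_add_neg, add_comm]

theorem superBracket_ham {p q : ZMod 2} {f g : Grassmann K n} (hf : f ∈ parity K n p)
    (hg : g ∈ parity K n q) :
    superBracket p q (ham f) (ham g) = (-1 : K) ^ p.val • ham (poisson f g) := by
  rw [ham_eq_fld, ham_eq_fld, superBracket_fld (fun k => pd_mem hf _) (fun k => pd_mem hg _),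
    ham_eq_fld, ← map_smul]
  congr 1
  funext k
  rw [Pi.smul_apply]
  refine (sign_poisson p q _ _).trans ?_
  congr 1
  rw [poisson, map_sum, fld_apply, fld_apply, ← sum_prime (fun m => pd K n (prime m) f * _),
    Finset.smul_sum, Finset.smul_sum, ← Finset.sum_neg_distrib, ← Finset.sum_sub_distrib]
  refine Finset.sum_congr rfl fun i _ => ?_
  have h1 : pd K n i (pd K n (prime k) f) ∈ parity K n p := by
    have := pd_mem (pd_mem hf (prime k)) i
    rwa [two_cancel] at this
  rw [pd_mul_of_mem (pd_mem hf i), pd_comm (prime k) i f, pd_comm (prime k) (prime i) g,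
    prime_prime, mul_neg, smul_neg, neg_mul, super_comm h1 (pd_mem hg (prime i)), sub_eq_add_neg]

/-- Replacing i by i' and anticommuting the derivatives shows that the sum is its own negative. -/
theorem sum_pd_pd_prime [CharZero K] (g : Grassmann K n) :
    ∑ i, pd K n i (pd K n (prime i) g) = 0 := by
  have h : ∑ i, pd K n i (pd K n (prime i) g) = -∑ i, pd K n i (pd K n (prime i) g) := by
    conv_lhs => rw [← sum_prime]
    rw [← Finset.sum_neg_distrib]
    refine Finset.sum_congr rfl fun i _ => ?_
    rw [prime_prime, pd_comm]
  rw [eq_neg_iff_add_eq_zero, ← two_smul K] at h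
  exact (smul_eq_zero.1 h).resolve_left two_ne_zero

/-- The Poisson bracket is a sum of partial derivatives. -/
theorem poisson_eq_sum_pd [CharZero K] (f g : Grassmann K n) :
    poisson f g = ∑ i, pd K n i (f * pd K n (prime i) g) := by
  simp only [pd_mul, Finset.sum_add_distrib, ← Finset.mul_sum, sum_pd_pd_prime, mul_zero, add_zero]
  rfl

theorem ham_one : ham (1 : Grassmann K n) = 0 := by
  rw [ham_eq_fld, fld_eq]
  exact Finset.sum_eq_zero fun k _ => by rw [pd_one, ← vfL_apply, map_zero]

theorem ham_lp_mem_H {l : List (Fin n)} (hl : l.length < n) : ham (lp K l) ∈ H K n := by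
  refine map_lp_mem_of_mono ham fun hnd => ?_
  have hc := List.toFinset_card_of_nodup hnd
  rw [mono_eq_lp, ← DH_mem_iff]
  rcases l with _ | ⟨a, l⟩
  · simp [DH_eq_ham, ham_one]
  refine Submodule.mem_iSup_of_mem _ (Submodule.mem_iSup_of_mem (Finset.mem_Icc.2 ?_)
    (Submodule.subset_span ⟨_, hc, rfl⟩))
  simp only [List.length_cons] at hl ⊢
  omega

theorem ham_pd_mem_H (i : Fin n) (f : Grassmann K n) : ham (pd K n i f) ∈ H K n := by
  induction f using lp_induction with
  | h l =>
    refine map_lp_mem_of_mono (ham ∘ₗ pd K n i) fun hnd => ?_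
    rw [mono_eq_lp]
    have hs := l.toFinset.sort_nodup (· ≤ ·)
    generalize l.toFinset.sort (· ≤ ·) = l at *
    by_cases hi : i ∈ l
    · have hp := List.perm_cons_erase hi
      have hn := hp.nodup_iff.1 hs
      refine lp_perm_mem (ham ∘ₗ pd K n i) hp.symm ?_
      rw [LinearMap.comp_apply, pd_lp_cons_self (List.nodup_cons.1 hn).1]
      refine ham_lp_mem_H ?_
      have := hn.length_le_card
      rw [List.length_cons, Fintype.card_fin] at this
      omega
    · rw [LinearMap.comp_apply, pd_lp_of_notMem hi, map_zero]
      exact zero_mem _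
  | h0 => rw [map_zero, map_zero]; exact zero_mem _
  | hadd a b ha hb => rw [map_add, map_add]; exact add_mem ha hb
  | hsmul c a ha => rw [map_smul, map_smul]; exact Submodule.smul_mem _ _ ha

theorem H_le_of_ham_mem {M : Submodule K (Gl K n)}
    (h : ∀ l : List (Fin n), l.Nodup → 1 ≤ l.length → l.length < n → ham (lp K l) ∈ M) :
    H K n ≤ M := by
  refine iSup₂_le fun d hd => ?_
  rw [HComp, Submodule.span_le]
  rintro _ ⟨u, hu, rfl⟩
  have := Finset.mem_Icc.1 hd
  rw [SetLike.mem_coe, mono_eq_lp, DH_mem_iff]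
  refine h _ (Finset.sort_nodup _ _) ?_ ?_ <;> rw [Finset.length_sort] <;> omega

theorem exists_notMem {l : List (Fin n)} (h : l.length < n) : ∃ i, i ∉ l := by
  by_contra! hc
  have : (Finset.univ : Finset (Fin n)) ⊆ l.toFinset := fun j _ => by simpa using hc j
  have := (Finset.card_le_card this).trans (List.toFinset_card_le _)
  simp at this
  omega

/-- Every monomial of degree below n is a derivative, and no derivative has a component of degree n.
As Poisson brackets are sums of derivatives, closure of H(n) follows. -/
theorem H_eq_span : H K n = Submodule.span K
    (Set.range fun x : Fin n × List (Fin n) => ham (pd K n x.1 (lp K x.2))) := by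
  refine le_antisymm (H_le_of_ham_mem fun l _ _ hl => ?_) ?_
  · obtain ⟨i, hi⟩ := exists_notMem hl
    refine Submodule.subset_span ⟨(i, i :: l), ?_⟩
    simp only [pd_lp_cons_self hi]
  · rw [Submodule.span_le]
    rintro _ ⟨x, rfl⟩
    exact ham_pd_mem_H _ _

theorem isSubLieSuperalgebra_H [CharZero K] : IsSubLieSuperalgebra (H K n) := by
  have h := H_eq_span (K := K) (n := n)
  rw [h]
  refine isSubLieSuperalgebra_span (par := fun x => x.2.length + 1)
    (fun x => ham_mem (pd_mem (lp_mem _) _)) fun x y => ?_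
  rw [superBracket_ham (pd_mem (lp_mem _) _) (pd_mem (lp_mem _) _), ← h, poisson_eq_sum_pd,
    map_sum]
  exact Submodule.smul_mem _ _ (sum_mem fun i _ => ham_pd_mem_H _ _)

theorem poisson_mem {M : Submodule K (Gl K n)} (hM : IsSubLieSuperalgebra M)
    {l l' : List (Fin n)} (h : ham (lp K l) ∈ M) (h' : ham (lp K l') ∈ M) :
    ham (poisson (lp K l) (lp K l')) ∈ M := by
  have := hM.bracket_mem _ _ _ ⟨h, ham_mem (lp_mem l)⟩ _ ⟨h', ham_mem (lp_mem l')⟩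
  rw [superBracket_ham (lp_mem l) (lp_mem l')] at this
  exact (Submodule.smul_mem_iff M (by simp)).1 this

theorem poisson_one (i : Fin n) (g : Grassmann K n) :
    poisson (lp K [i]) g = pd K n (prime i) g := by
  simp [poisson, ← xi_eq_lp, pd_xi]

theorem poisson_two (i j : Fin n) (g : Grassmann K n) :
    poisson (lp K [i, j]) g =
      xi K n j * pd K n (prime i) g - xi K n i * pd K n (prime j) g := by
  simp [poisson, lp_cons, pd_xi_mul, pd_xi, sub_mul, ite_mul]

theorem poisson_three (i j k : Fin n) (g : Grassmann K n) :
    poisson (lp K [i, j, k]) g = lp K [j, k] * pd K n (prime i) g -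
      lp K [i, k] * pd K n (prime j) g + lp K [i, j] * pd K n (prime k) g := by
  simp [poisson, lp_cons, pd_xi_mul, pd_xi, sub_mul, mul_sub, ite_mul, mul_assoc]
  abel

end Poisson

/-! ### Generating H(n) -/

section HGeneration

variable {K : Type*} [Field K] {n : ℕ} {M : Submodule K (Gl K n)}

theorem ham_pair_mem (hM : IsSubLieSuperalgebra M) (h1 : ∀ i : Fin n, ham (lp K [i]) ∈ M)
    {i j k : Fin n} (hij : i ≠ j) (hik : i ≠ k) (h : ham (lp K [i, j, k]) ∈ M) :
    ham (lp K [j, k]) ∈ M := by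
  have := poisson_mem hM (h1 (prime i)) h
  rwa [poisson_one, prime_prime, pd_lp_cons_self (by simp [hij, hik])] at this

/-- For l outside the orbits of i and k, which exists as n ≥ 5, the Poisson bracket of ξ_iξ_l with
ξ_{l'}ξ_{i'}ξ_k is, up to sign, ξ_lξ_{l'}ξ_k + ξ_iξ_{i'}ξ_k. Exchanging l and l' reverses the first
term, so adding the two versions isolates the second. -/
theorem ham_triple_mem (hM : IsSubLieSuperalgebra M) [CharZero K] (hn : 5 ≤ n)
    (h1 : ∀ i : Fin n, ham (lp K [i]) ∈ M)
    (h3 : ∀ i j k : Fin n, i ≠ j → i ≠ k → j ≠ k → prime i ≠ j → prime i ≠ k → prime j ≠ k →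
      ham (lp K [i, j, k]) ∈ M) {i k : Fin n} (hik : i ≠ k)
    (hik' : prime i ≠ k) : ham (lp K [i, prime i, k]) ∈ M := by
  have h2 : ∀ j k : Fin n, j ≠ k → prime j ≠ k → ham (lp K [j, k]) ∈ M := by
    intro j k hjk hjk'
    obtain ⟨i, hi⟩ := exists_notMem (l := [j, prime j, k, prime k]) (by simp; omega)
    simp only [List.mem_cons, List.not_mem_nil, or_false, not_or] at hi
    refine ham_pair_mem hM h1 hi.1 hi.2.2.1 (h3 i j k hi.1 hi.2.2.1 hjk ?_ ?_ hjk')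
    · exact fun e => hi.2.1 (prime_eq_comm.1 e)
    · exact fun e => hi.2.2.2 (prime_eq_comm.1 e)
  have key : ∀ l : Fin n, l ≠ i → l ≠ prime i → l ≠ k → l ≠ prime k →
      ham (lp K [l, prime l, k] + lp K [i, prime i, k]) ∈ M := by
    intro l hl1 hl2 hl3 hl4
    have hl5 : prime l ≠ prime i := prime_ne_of_ne hl1
    have hl6 : prime l ≠ k := fun e => hl4 (prime_eq_comm.1 e)
    have := poisson_mem hM (h2 i l (Ne.symm hl1) (Ne.symm hl2))
      (h3 (prime l) (prime i) k hl5 hl6 hik' (by rwa [prime_prime]) (by rwa [prime_prime])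
        (by rwa [prime_prime]))
    rw [poisson_two, pd_lp_cons_self (by simp [hl5, hl6]), lp_cons (prime l), pd_xi_mul,
      if_neg hl5, pd_lp_cons_self (by simpa using hik'), zero_sub, mul_neg, ← lp_cons, ← lp_cons,
      ← lp_cons, ← neg_add', map_neg, neg_mem_iff] at this
    exact this
  obtain ⟨l, hl⟩ := exists_notMem (l := [i, prime i, k, prime k]) (by simp; omega)
  simp only [List.mem_cons, List.not_mem_nil, or_false, not_or] at hl
  obtain ⟨hl1, hl2, hl3, hl4⟩ := hl
  have k1 := key l hl1 hl2 hl3 hl4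
  have k2 := key (prime l) (fun e => hl2 (prime_eq_comm.1 e)) (prime_ne_of_ne hl1)
    (fun e => hl4 (prime_eq_comm.1 e)) (prime_ne_of_ne hl3)
  have e : lp K [prime l, l, k] = -lp K [l, prime l, k] := by
    simp only [lp_cons]; rw [xi_mul_xi_mul_comm]
  rw [prime_prime, e] at k2
  have k3 := add_mem k1 k2
  rw [← map_add, show ∀ a b : Grassmann K n, a + b + (-a + b) = (2 : K) • b from
    fun a b => by rw [two_smul]; abel, map_smul] at k3
  exact (Submodule.smul_mem_iff M two_ne_zero).1 k3

theorem ham_mem_of_nodup_triple (hM : IsSubLieSuperalgebra M) [CharZero K] (hn : 5 ≤ n)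
    (h1 : ∀ i : Fin n, ham (lp K [i]) ∈ M)
    (h3 : ∀ i j k : Fin n, i ≠ j → i ≠ k → j ≠ k → prime i ≠ j → prime i ≠ k → prime j ≠ k →
      ham (lp K [i, j, k]) ∈ M) (i j k : Fin n) (hij : i ≠ j) (hik : i ≠ k) (hjk : j ≠ k) :
    ham (lp K [i, j, k]) ∈ M := by
  by_cases h : prime i = j
  · subst h
    exact ham_triple_mem hM hn h1 h3 hik hjk
  by_cases h' : prime i = k
  · subst h'
    exact lp_perm_mem ham ((List.Perm.swap _ _ _).cons _)
      (ham_triple_mem hM hn h1 h3 hij (Ne.symm hjk))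
  by_cases h'' : prime j = k
  · subst h''
    exact lp_perm_mem ham (((List.Perm.swap _ _ _).cons _).trans (List.Perm.swap _ _ _))
      (ham_triple_mem hM hn h1 h3 (Ne.symm hij) (Ne.symm hik))
  exact h3 i j k hij hik hjk h h' h''

theorem mul_pd_prime_eq_zero {i j k : Fin n} {b : List (Fin n)} (hij : i ≠ j)
    (h : prime j ∉ b ∨ prime i = i ∨ prime i = k) :
    lp K [i, k] * pd K n (prime j) (lp K (prime i :: b)) = 0 := by
  rw [lp_cons (prime i), pd_xi_mul, if_neg (prime_ne_of_ne hij), zero_sub, mul_neg, neg_eq_zero]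
  rcases h with h | h
  · rw [pd_lp_of_notMem h, mul_zero, mul_zero]
  · rw [← mul_assoc, xi_eq_lp, ← lp_append, lp_of_not_nodup, zero_mul]
    rcases h with h | h <;> simp [h]

/-- The Poisson bracket of ξ_iξ_jξ_k with ξ_{i'}x^b has three terms. The first is ξ_jξ_k x^b, and
`hj` and `hk` make the others vanish. -/
theorem ham_cons_cons_mem (hM : IsSubLieSuperalgebra M) {i j k : Fin n} {b : List (Fin n)}
    (hij : i ≠ j) (hik : i ≠ k) (hb : prime i ∉ b) (hj : prime j ∉ b ∨ prime i = i ∨ prime i = k)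
    (hk : prime k ∉ b ∨ prime i = i ∨ prime i = j) (h3 : ham (lp K [i, j, k]) ∈ M)
    (h : ham (lp K (prime i :: b)) ∈ M) : ham (lp K (j :: k :: b)) ∈ M := by
  have := poisson_mem hM h3 h
  rwa [poisson_three, pd_lp_cons_self hb, mul_pd_prime_eq_zero hij hj,
    mul_pd_prime_eq_zero hik hk, sub_zero, add_zero, ← lp_append] at this

/-- Induction on the degree through `ham_cons_cons_mem`: since the degree is below n, some index i
is missing, and the factors j, k are chosen to kill the unwanted terms. -/
theorem ham_lp_mem (hM : IsSubLieSuperalgebra M)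
    (h1 : ∀ i : Fin n, ham (lp K [i]) ∈ M)
    (h3 : ∀ i j k : Fin n, i ≠ j → i ≠ k → j ≠ k → ham (lp K [i, j, k]) ∈ M) :
    ∀ l : List (Fin n), l.Nodup → 1 ≤ l.length → l.length < n → ham (lp K l) ∈ M := by
  intro l
  induction hd : l.length generalizing l with
  | zero => intro _ h; omega
  | succ d ih =>
    intro hl _ hlen
    obtain ⟨i, hi⟩ := exists_notMem (hd ▸ hlen)
    have raise : ∀ j k b, l.Perm (j :: k :: b) → prime i ∉ b →
        (prime j ∉ b ∨ prime i = i ∨ prime i = k) → (prime k ∉ b ∨ prime i = i ∨ prime i = j) →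
        ham (lp K l) ∈ M := by
      intro j k b hp hb hj hk
      have hnd := hp.nodup_iff.1 hl
      have hi' : i ∉ j :: k :: b := fun h => hi (hp.mem_iff.2 h)
      have hlen' := hp.length_eq
      simp only [List.mem_cons, not_or, List.nodup_cons, List.length_cons] at hi' hnd hlen'
      refine lp_perm_mem ham hp.symm (ham_cons_cons_mem hM hi'.1 hi'.2.1 hb hj hk
        (h3 i j k hi'.1 hi'.2.1 hnd.1.1) (ih _ ?_ (List.nodup_cons.2 ⟨hb, hnd.2.2⟩) ?_ ?_)) <;>
        (try rw [List.length_cons]) <;> omega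
    rcases l with _ | ⟨j, _ | ⟨k, b⟩⟩
    · simp at hd
    · exact h1 j
    -- If i' occurs, it serves as one of the two chosen factors.
    by_cases hpi : prime i ∈ j :: k :: b
    · have hp := List.perm_cons_erase hpi
      have hnd := hp.nodup_iff.1 hl
      have hlen' := hp.length_eq
      generalize (j :: k :: b).erase (prime i) = r at *
      rcases r with _ | ⟨m, c⟩
      · simp at hlen'
      have hi' : i ∉ prime i :: m :: c := fun h => hi (hp.mem_iff.2 h)
      simp only [List.mem_cons, not_or, List.nodup_cons] at hnd hi'
      exact raise _ _ _ hp hnd.1.2 (Or.inl (by rw [prime_prime]; exact hi'.2.2))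
        (Or.inr (Or.inr rfl))
    -- Otherwise a pair m ≠ m' is chosen if there is one. If there is none, any two factors work, as
    -- no partner of either remains in b.
    by_cases hpair : ∃ m ∈ j :: k :: b, prime m ≠ m ∧ prime m ∈ j :: k :: b
    · obtain ⟨m, hm, hne, hm'⟩ := hpair
      have hp := List.perm_cons_erase hm
      have hp2 := List.perm_cons_erase ((List.mem_erase_of_ne hne).2 hm')
      have hp3 := hp.trans (hp2.cons m)
      have hnd := hp3.nodup_iff.1 hl
      simp only [List.mem_cons, not_or, List.nodup_cons] at hnd
      exact raise _ _ _ hp3 (fun h => hpi (hp3.mem_iff.2 (by simp [h]))) (Or.inl hnd.2.1)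
        (Or.inl (by rw [prime_prime]; exact hnd.1.2))
    · push Not at hpair
      have hnd := hl
      simp only [List.mem_cons, not_or, List.nodup_cons] at hnd
      have key : ∀ m ∈ j :: k :: b, m ∉ b → prime m ∉ b := by
        intro m hm hmb hm'
        by_cases e : prime m = m
        · exact hmb (e ▸ hm')
        · exact hpair m hm e (by simp [hm'])
      exact raise j k b (List.Perm.refl _) (fun h => hpi (by simp [h]))
        (Or.inl (key j (by simp) hnd.1.2)) (Or.inl (key k (by simp) hnd.2.1))

/-- The index sets of the generators of `H(n)`: one or three indices from distinct orbits of the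
involution. -/
def transversals (n : ℕ) : Finset (Finset (Fin n)) :=
  Finset.univ.filter fun u => (u.card = 1 ∨ u.card = 3) ∧ ∀ k ∈ u, prime k ∈ u → prime k = k

theorem mem_transversals {u : Finset (Fin n)} : u ∈ transversals n ↔
    (u.card = 1 ∨ u.card = 3) ∧ ∀ k ∈ u, prime k ∈ u → prime k = k := by simp [transversals]

/-- The difference of the indicators of u and v is invariant under the involution, so an index in
only one of them is fixed. At most one index is fixed; as `a` vanishes there, the eigenvalue cannot
detect it, but the parity of the cardinalities does. -/
theorem subset_of_transversal {u v : Finset (Fin n)}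
    (hu : ∀ k ∈ u, prime k ∈ u → prime k = k) (hv : ∀ k ∈ v, prime k ∈ v → prime k = k)
    (hcu : Odd u.card) (hcv : Odd v.card)
    (h : ∀ k, ((if k ∈ u then 1 else 0) - (if k ∈ v then 1 else 0) : ℤ) =
      (if prime k ∈ u then 1 else 0) - (if prime k ∈ v then 1 else 0)) : u ⊆ v := by
  have fixed : ∀ k, (k ∈ u ∧ k ∉ v) ∨ (k ∈ v ∧ k ∉ u) → prime k = k := by
    rintro k (⟨h1, h2⟩ | ⟨h1, h2⟩) <;> have := h k <;> simp only [h1, h2, if_true, if_false] at this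
    · exact hu k h1 (by by_contra h3; simp only [h3, if_false] at this; split_ifs at this <;> omega)
    · exact hv k h1 (by by_contra h3; simp only [h3, if_false] at this; split_ifs at this <;> omega)
  intro z hz
  by_contra hzv
  have hfz := fixed z (Or.inl ⟨hz, hzv⟩)
  have e : u = insert z v := by
    ext k
    rw [Finset.mem_insert]
    constructor
    · intro hk
      by_cases hkv : k ∈ v
      · exact Or.inr hkv
      · exact Or.inl (eq_of_prime_eq_self (fixed k (Or.inl ⟨hk, hkv⟩)) hfz)
    · rintro (rfl | hk)
      · exact hz
      · by_contra hku
        exact hku (eq_of_prime_eq_self (fixed k (Or.inr ⟨hk, hku⟩)) hfz ▸ hz)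
  rw [e, Finset.card_insert_of_notMem hzv] at hcu
  exact (Nat.not_odd_iff_even.2 hcv.add_one) hcu

/-- By antisymmetry of `a`, the sum ∑ a_k ham(ξ_{k'}ξ_k) counts the diagonal field twice. -/
theorem eul_mem_H [CharZero K] (hn : 3 ≤ n) {a : Fin n → K} (ha : ∀ k, a (prime k) = -a k) :
    eul a ∈ H K n := by
  have e : ∀ k : Fin n, ham (lp K [prime k, k]) =
      vf (xi K n k) k - vf (xi K n (prime k)) (prime k) := by
    intro k
    rw [ham_eq_fld, vf_eq_fld, vf_eq_fld, ← map_sub]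
    congr 1
    funext m
    have e1 : prime k = prime m ↔ m = k := by rw [prime_eq_comm, prime_prime, eq_comm]
    have e2 : k = prime m ↔ m = prime k := by rw [← prime_eq_comm, eq_comm]
    rw [lp_cons, ← xi_eq_lp, pd_xi_mul, pd_xi, Pi.sub_apply, Pi.single_apply, Pi.single_apply]
    simp only [e1, e2, mul_ite, mul_one, mul_zero]
  have h2 : (2 : K) • eul a = ∑ k, a k • ham (lp K [prime k, k]) := by
    have h3 : ∑ k, a k • vf (xi K n (prime k)) (prime k) = -eul a := by
      rw [← sum_prime, eul, fld_eq, ← Finset.sum_neg_distrib]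
      refine Finset.sum_congr rfl fun k _ => ?_
      rw [prime_prime, ha, ← vfL_apply, ← vfL_apply, map_smul]
      exact neg_smul (M := Gl K n) (a k) (vf (xi K n k) k)
    have h4 : ∑ k, a k • vf (xi K n k) k = eul a := by
      rw [eul, fld_eq]
      refine Finset.sum_congr rfl fun k _ => ?_
      rw [← vfL_apply, ← vfL_apply, map_smul]
    simp only [e, smul_sub, Finset.sum_sub_distrib]
    rw [h3, h4, two_smul, sub_neg_eq_add]
  refine (Submodule.smul_mem_iff _ (two_ne_zero (α := K))).1 ?_
  rw [h2]
  exact sum_mem fun k _ => Submodule.smul_mem _ _ (ham_lp_mem_H (by simp; omega))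

theorem isGeneratedByOne_H [CharZero K] (hn : 5 ≤ n) : IsGeneratedByOne (H K n) := by
  obtain ⟨a, ha, hd⟩ := exists_antisymmetric K (prime (n := n)) prime_prime
  have hodd : ∀ u ∈ transversals n, Odd u.card := by
    intro u hu
    rcases (mem_transversals.1 hu).1 with h | h <;> rw [h] <;> decide
  have hp : ∀ u ∈ transversals n, mono K n u ∈ parity K n 1 := fun u hu =>
    lp_mem_of_odd (by simpa using hodd u hu)
  refine isGeneratedByOne_of_eigenvectors isSubLieSuperalgebra_H (eul_mem_H (by omega) ha)
    (eul_mem a) (transversals n) (fun u => ham (mono K n u)) (fun u => ∑ k ∈ u, a k) ?_ ?_ ?_ ?_ ?_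
  · intro u hu
    refine ham_lp_mem_H ?_
    rw [Finset.length_sort]
    have := (mem_transversals.1 hu).1
    omega
  · intro u hu
    exact ham_mem (hp u hu)
  · intro u hu
    rw [ham_eq_fld]
    refine eul_bracket a (q := 1) (fun k => pd_mem (hp u hu) _) fun k => ?_
    rw [eul_pd a _ _ (eul_mono a u), ha, sub_neg_eq_add]
  · intro u hu v hv h
    have h' := hd (fun k => (if k ∈ u then 1 else 0) - if k ∈ v then 1 else 0)
      (fun k => by split_ifs <;> simp) (by
        simp only at h
        simp [sub_mul, Finset.sum_sub_distrib, h])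
    have hu' := (mem_transversals.1 hu).2
    have hv' := (mem_transversals.1 hv).2
    refine Finset.Subset.antisymm
      (subset_of_transversal hu' hv' (hodd u hu) (hodd v hv) h')
      (subset_of_transversal hv' hu' (hodd v hv) (hodd u hu) fun k => ?_)
    have := h' k
    linarith
  · intro M hM _ hv
    have h1 : ∀ i : Fin n, ham (lp K [i]) ∈ M := fun i =>
      map_lp_mem_of_mono ham fun _ => hv _ (mem_transversals.2 (by simp))
    refine H_le_of_ham_mem (ham_lp_mem hM h1 (ham_mem_of_nodup_triple hM hn h1 ?_))
    intro i j k hij hik hjk hij' hik' hjk'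
    refine map_lp_mem_of_mono ham fun hnd => hv _ (mem_transversals.2 ⟨Or.inr ?_, ?_⟩)
    · rw [List.toFinset_card_of_nodup hnd]; rfl
    · have e : ∀ x y : Fin n, prime x ≠ y → prime y ≠ x :=
        fun x y h e => h (by rw [← e, prime_prime])
      intro x hx hx'
      simp only [List.mem_toFinset, List.mem_cons, List.not_mem_nil, or_false] at hx hx'
      rcases hx with rfl | rfl | rfl <;> rcases hx' with h | h | h <;>
        first
        | exact h
        | exact absurd h (by assumption)
        | exact absurd h (e _ _ (by assumption))

end HGeneration

end

end CartanSuper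

theorem mainTheorem2 (K : Type*) [Field K] [IsAlgClosed K] [CharZero K] :
    (∀ n : ℕ, 3 ≤ n → CartanSuper.IsGeneratedByOne (CartanSuper.W K n)) ∧
    (∀ n : ℕ, 4 ≤ n → CartanSuper.IsGeneratedByOne (CartanSuper.S K n)) ∧
    (∀ m : ℕ, 2 ≤ m → CartanSuper.IsGeneratedByOne (CartanSuper.STilde K (2 * m))) ∧
    (∀ n : ℕ, 5 ≤ n → CartanSuper.IsGeneratedByOne (CartanSuper.H K n)) :=
  ⟨fun _ hn => CartanSuper.isGeneratedByOne_W hn,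
    fun _ hn => CartanSuper.isGeneratedByOne_S (by omega),
    fun m hm => CartanSuper.isGeneratedByOne_STilde (even_two_mul m) (by omega),
    fun _ hn => CartanSuper.isGeneratedByOne_H hn⟩
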